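/- For a field $k$ let $\mathrm{PSF}(k)=\bigcup_{n\ge 1}k((t^{1/n}))\subseteq k((t^{\mathbb Q}))$ be the Puiseux series field over $k$, with the $t$-adic valuation $v$ (value group $\mathbb Q$), and let $\mathrm{PSF}(k)^c$ be its completion with respect to $v$. If $k$ is ordered, order $\mathrm{PSF}(k)$ by letting a series be positive if and only if its leading coefficient (the coefficient of the smallest exponent) is positive, and order $\mathrm{PSF}(k)^c$ so that its set of nonnegative elements is the closure of the set of nonnegative elements of $\mathrm{PSF}(k)$. A subring $R$, not required to contain $1$, of a valued field $L$ with valuation ring $\mathcal O$ is an *additive complement* of $\mathcal O$ if $R\cap\mathcal O=\{0\}$ and $R+\mathcal O=L$. An *integer part* of an ordered field $L$ is a subring $I$ with $1$ which has no element strictly between $0$ and $1$ and such that for every $a\in L$ there is $r\in I$ with $r\le a<r+1$. For a subring $S$ of $L$, $\operatorname{Quot}S\subseteq L$ is its quotient field. Let $N_k\subseteq\mathrm{PSF}(k)$ be the ring of all finite sums of monomials $ct^g$ with $c\in k$, $g\in\mathbb Q$, $g<0$. (1) Let $k$ be a countable field and let $L$ be $\mathrm{PSF}(k)$ or $\mathrm{PSF}(k)^c$.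 Then $L$ is uncountable and its valuation ring is henselian, $N_k$ is countable, and $N_k$ is an additive complement of the valuation ring of $L$. If $R$ is any subring of $L$ which is an additive complement of the valuation ring, then $\operatorname{Quot}R$ is countable and $\operatorname{trdeg}(L|\operatorname{Quot}R)$ is uncountable. (2) Let in addition $k$ be ordered. If $I$ is any integer part of $L$, then $\operatorname{Quot}I$ is countable and $\operatorname{trdeg}(L|\operatorname{Quot}I)$ is uncountable. If the ordering of $k$ is archimedean, then $N_k+\mathbb Z$ is an integer part of $L$. If $k$ is real closed, then $L$ is real closed. (3) Let $k=\mathbb Q^{\rm rc}$ be the field of real algebraic numbers and let $L$ be $\mathrm{PSF}(\mathbb Q^{\rm rc})$ or its completion. Then $L$ is real closed, and for every integer part $I$ of $L$, $\operatorname{Quot}I$ is a proper countable subfield of $L$ such that $\operatorname{trdeg}(L|\operatorname{Quot}I)$ is uncountable. -/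

import Mathlib

universe u

section HahnField

variable (k : Type u) [Field k]

/-- The additive embedding `m ↦ m / n` of `ℤ` into `ℚ`. -/
def divHom (n : ℕ+) : ℤ →+ ℚ where
  toFun m := (m : ℚ) / (n : ℚ)
  map_zero' := by simp
  map_add' a b := by push_cast; ring

theorem divHom_le_iff (n : ℕ+) (a b : ℤ) : divHom n a ≤ divHom n b ↔ a ≤ b := by
  have hn : (0 : ℚ) < ((n : ℕ) : ℚ) := by exact_mod_cast n.pos
  change (a : ℚ) / ((n : ℕ) : ℚ) ≤ (b : ℚ) / ((n : ℕ) : ℚ) ↔ a ≤ b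
  rw [div_le_div_iff_of_pos_right hn]
  exact_mod_cast Iff.rfl

theorem divHom_injective (n : ℕ+) : Function.Injective (divHom n) := fun a b h =>
  le_antisymm ((divHom_le_iff n a b).1 h.le) ((divHom_le_iff n b a).1 h.ge)

/-- The embedding of the field of formal Laurent series `k((t))` into `k((t^ℚ))` that sends `t`
to `t^(1/n)`; its range is `k((t^(1/n)))`. -/
noncomputable def laurentEmb (n : ℕ+) : LaurentSeries k →+* HahnSeries ℚ k :=
  HahnSeries.embDomainRingHom (divHom n) (divHom_injective n) (divHom_le_iff n)

theorem mem_laurentEmb_range_iff (n : ℕ+) (x : HahnSeries ℚ k) :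
    x ∈ (laurentEmb k n).fieldRange ↔ ∀ q ∈ x.support, ∃ m : ℤ, q = (m : ℚ) / (n : ℚ) := by
  constructor
  · rintro ⟨y, rfl⟩ q hq
    by_contra hcon
    apply hq
    apply HahnSeries.embDomain_of_notMem_range
    rintro ⟨m, hm⟩
    exact hcon ⟨m, hm.symm⟩
  · intro h
    have hpwo : {m : ℤ | x.coeff (divHom n m) ≠ 0}.IsPWO := by
      intro f
      obtain ⟨i, j, hij, hle⟩ := x.isPWO_support (fun i => ⟨divHom n (f i), (f i).2⟩)
      exact ⟨i, j, hij, (divHom_le_iff n _ _).1 hle⟩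
    refine ⟨⟨fun m => x.coeff (divHom n m), hpwo⟩, ?_⟩
    ext q
    by_cases hq : q ∈ Set.range (divHom n)
    · obtain ⟨m, rfl⟩ := hq
      exact HahnSeries.embDomain_coeff
    · have h0 : x.coeff q = 0 := by
        by_contra h0
        obtain ⟨m, hm⟩ := h q h0
        exact hq ⟨m, hm.symm⟩
      rw [h0]
      exact HahnSeries.embDomain_of_notMem_range hq

theorem laurentEmb_range_mono {m n : ℕ+} (h : m ∣ n) :
    (laurentEmb k m).fieldRange ≤ (laurentEmb k n).fieldRange := by
  obtain ⟨d, rfl⟩ := h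
  intro x hx
  rw [mem_laurentEmb_range_iff] at hx ⊢
  intro q hq
  obtain ⟨a, rfl⟩ := hx q hq
  refine ⟨a * (d : ℕ), ?_⟩
  have h1 : ((m : ℕ) : ℚ) ≠ 0 := by exact_mod_cast m.ne_zero
  have h2 : ((d : ℕ) : ℚ) ≠ 0 := by exact_mod_cast d.ne_zero
  push_cast
  field_simp

/-- The subfield `⋃ n, k((t^(1/n)))` of `k((t^ℚ))`. -/
noncomputable def puiseuxSubfield : Subfield (HahnSeries ℚ k) where
  carrier := ⋃ n : ℕ+, ((laurentEmb k n).fieldRange : Set (HahnSeries ℚ k))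
  mul_mem' {a b} ha hb := by
    obtain ⟨m, hm⟩ := Set.mem_iUnion.1 ha
    obtain ⟨n, hn⟩ := Set.mem_iUnion.1 hb
    exact Set.mem_iUnion.2 ⟨m * n, mul_mem (laurentEmb_range_mono k (dvd_mul_right m n) hm)
      (laurentEmb_range_mono k (dvd_mul_left n m) hn)⟩
  add_mem' {a b} ha hb := by
    obtain ⟨m, hm⟩ := Set.mem_iUnion.1 ha
    obtain ⟨n, hn⟩ := Set.mem_iUnion.1 hb
    exact Set.mem_iUnion.2 ⟨m * n, add_mem (laurentEmb_range_mono k (dvd_mul_right m n) hm)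
      (laurentEmb_range_mono k (dvd_mul_left n m) hn)⟩
  one_mem' := Set.mem_iUnion.2 ⟨1, one_mem (laurentEmb k 1).fieldRange⟩
  zero_mem' := Set.mem_iUnion.2 ⟨1, zero_mem (laurentEmb k 1).fieldRange⟩
  neg_mem' {a} ha := by
    obtain ⟨m, hm⟩ := Set.mem_iUnion.1 ha
    exact Set.mem_iUnion.2 ⟨m, neg_mem (S := Subfield (HahnSeries ℚ k)) hm⟩
  inv_mem' a ha := by
    obtain ⟨m, hm⟩ := Set.mem_iUnion.1 ha
    exact Set.mem_iUnion.2 ⟨m, inv_mem (S := Subfield (HahnSeries ℚ k)) hm⟩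

/-- The Puiseux series field over `k`. -/
def PSF : Type u := puiseuxSubfield k

noncomputable instance : Field (PSF k) := inferInstanceAs (Field (puiseuxSubfield k))

/-- The inclusion of the Puiseux series field in `k((t^ℚ))`. -/
noncomputable def PSF.toHahn : PSF k →+* HahnSeries ℚ k := (puiseuxSubfield k).subtype

theorem PSF.toHahn_injective : Function.Injective (PSF.toHahn k) := Subtype.val_injective

/-- The `t`-adic valuation of the Puiseux series field, with value group `ℚ`, written
multiplicatively: a larger order in `t` means a smaller value. -/
noncomputable def PSF.val : Valuation (PSF k) (Multiplicative (WithTop ℚ)ᵒᵈ) :=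
  (AddValuation.toValuation (HahnSeries.addVal ℚ k)).comap (PSF.toHahn k)

theorem PSF.val_le_iff (a b : PSF k) :
    PSF.val k a ≤ PSF.val k b ↔ (PSF.toHahn k b).orderTop ≤ (PSF.toHahn k a).orderTop := by
  simp only [← HahnSeries.addVal_apply]
  exact Iff.rfl

/-- The completion of the Puiseux series field with respect to its valuation. -/
noncomputable abbrev PSFCompletion : Type u := (PSF.val k).Completion

/-- The embedding of the Puiseux series field in its completion. -/
noncomputable def PSF.toCompletion : PSF k →+* PSFCompletion k :=
  UniformSpace.Completion.coeRingHom.comp (WithVal.equiv (PSF.val k)).symm.toRingHom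

/-- The valuation ring of the Puiseux series field. -/
noncomputable abbrev PSF.valRing : ValuationSubring (PSF k) := (PSF.val k).valuationSubring

/-- The valuation ring of the completion of the Puiseux series field. -/
noncomputable abbrev PSFCompletion.valRing : ValuationSubring (PSFCompletion k) :=
  (Valued.v : Valuation (PSFCompletion k) (Multiplicative (WithTop ℚ)ᵒᵈ)).valuationSubring

theorem PSF.val_toCompletion (a : PSF k) :
    (Valued.v : Valuation (PSFCompletion k) (Multiplicative (WithTop ℚ)ᵒᵈ))
      (PSF.toCompletion k a) = PSF.val k a :=
  Valued.valuedCompletion_apply (K := WithVal (PSF.val k)) _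

/-- The finite sums of monomials `c t^g` with `c ∈ k` and `g ∈ ℚ`, `g < 0`. They form a subring
without `1`. -/
noncomputable def PSF.neg : NonUnitalSubring (PSF k) where
  carrier := {x | (PSF.toHahn k x).support.Finite ∧ ∀ g ∈ (PSF.toHahn k x).support, g < 0}
  zero_mem' := by simp
  add_mem' {a b} ha hb := by
    have hsub : (PSF.toHahn k (a + b)).support ⊆
        (PSF.toHahn k a).support ∪ (PSF.toHahn k b).support := by
      intro g hg
      by_contra hcon
      simp only [Set.mem_union, HahnSeries.mem_support, not_or, not_not] at hcon
      exact hg (by rw [map_add, HahnSeries.coeff_add, hcon.1, hcon.2, add_zero])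
    exact ⟨(ha.1.union hb.1).subset hsub, fun g hg => (hsub hg).elim (ha.2 g) (hb.2 g)⟩
  neg_mem' {a} ha := by
    have h : (PSF.toHahn k (-a)).support = (PSF.toHahn k a).support := by
      rw [map_neg]; exact HahnSeries.support_neg
    change (PSF.toHahn k (-a)).support.Finite ∧ ∀ g ∈ (PSF.toHahn k (-a)).support, g < 0
    rw [h]
    exact ha
  mul_mem' {a b} ha hb := by
    have hsub : (PSF.toHahn k (a * b)).support ⊆
        Set.image2 (· + ·) (PSF.toHahn k a).support (PSF.toHahn k b).support := by
      rw [map_mul]; exact HahnSeries.support_mul_subset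
    refine ⟨(ha.1.image2 _ hb.1).subset hsub, fun g hg => ?_⟩
    obtain ⟨x, hx, y, hy, rfl⟩ := hsub hg
    have h1 := ha.2 x hx
    have h2 := hb.2 y hy
    change x + y < 0
    linarith

theorem PSFCompletion.exists_near {s : Set (PSF k)} {x : PSFCompletion k}
    (hx : x ∈ closure (PSF.toCompletion k '' s)) (h0 : x ≠ 0) :
    ∃ a ∈ s, (Valued.v : Valuation (PSFCompletion k) (Multiplicative (WithTop ℚ)ᵒᵈ))
      (PSF.toCompletion k a - x) < Valued.v x := by
  have hr : Valued.v.restrict x ≠ 0 := by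
    simpa using h0
  have hmem : {y : PSFCompletion k | Valued.v.restrict (y - x) < Valued.v.restrict x} ∈ nhds x :=
    Valued.mem_nhds.2 ⟨Units.mk0 _ hr, subset_rfl⟩
  obtain ⟨y, hy, a, ha, rfl⟩ := mem_closure_iff_nhds.1 hx _ hmem
  exact ⟨a, ha, (Valuation.restrict_lt_iff _).1 hy⟩

end HahnField

section Order

variable (k : Type u) [Field k] [LinearOrder k]

/-- The ordering of the Puiseux series field that extends the ordering of `k` and in which
`a < b` if and only if the leading coefficient of `b - a` is positive. -/
noncomputable instance : LinearOrder (PSF k) :=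
  LinearOrder.lift' (fun x => toLex (PSF.toHahn k x))
    (fun _ _ h => PSF.toHahn_injective k (toLex.injective h))

theorem PSF.le_iff (a b : PSF k) :
    a ≤ b ↔ toLex (PSF.toHahn k a) ≤ toLex (PSF.toHahn k b) := Iff.rfl

variable [IsStrictOrderedRing k]

instance : IsStrictOrderedRing (PSF k) :=
  Function.Injective.isStrictOrderedRing (fun x => toLex (PSF.toHahn k x))
    (by rw [map_zero]; rfl) (by rw [map_one]; rfl) (fun a b => by rw [map_add]; rfl)
    (fun a b => by rw [map_mul]; rfl) Iff.rfl Iff.rfl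

theorem PSF.val_le_val {a b : PSF k} (ha : 0 ≤ a) (hab : a ≤ b) : PSF.val k a ≤ PSF.val k b := by
  rw [PSF.val_le_iff]
  by_contra hcon
  push Not at hcon
  have h := HahnSeries.abs_lt_abs_of_orderTop_ofLex
    (x := toLex (PSF.toHahn k b)) (y := toLex (PSF.toHahn k a)) hcon
  have ha' : (0 : Lex (HahnSeries ℚ k)) ≤ toLex (PSF.toHahn k a) := by
    have := (PSF.le_iff k 0 a).1 ha
    rwa [map_zero] at this
  have hab' := (PSF.le_iff k a b).1 hab
  rw [abs_of_nonneg ha', abs_of_nonneg (ha'.trans hab')] at h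
  exact absurd hab' (not_le.2 h)

/-- The nonnegative elements of the completion: the topological closure of the set of nonnegative
elements of the Puiseux series field. -/
def PSFCompletion.nonneg : Set (PSFCompletion k) :=
  closure (PSF.toCompletion k '' {a | 0 ≤ a})

/-- The nonnegative elements form a cone. -/
def PSFCompletion.cone : RingCone (PSFCompletion k) where
  carrier := PSFCompletion.nonneg k
  zero_mem' := subset_closure ⟨0, le_refl (0 : PSF k), map_zero _⟩
  one_mem' := subset_closure ⟨1, zero_le_one (α := PSF k), map_one _⟩
  add_mem' {x y} hx hy := by
    refine map_mem_closure₂ continuous_add hx hy ?_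
    rintro _ ⟨a, ha, rfl⟩ _ ⟨b, hb, rfl⟩
    exact ⟨a + b, add_nonneg (α := PSF k) ha hb, map_add _ _ _⟩
  mul_mem' {x y} hx hy := by
    refine map_mem_closure₂ continuous_mul hx hy ?_
    rintro _ ⟨a, ha, rfl⟩ _ ⟨b, hb, rfl⟩
    exact ⟨a * b, mul_nonneg (α := PSF k) ha hb, map_mul _ _ _⟩
  eq_zero_of_mem_of_neg_mem' {x} hx hnx := by
    by_contra h0
    obtain ⟨a, ha, hax⟩ := PSFCompletion.exists_near k hx h0
    obtain ⟨b, hb, hbx⟩ := PSFCompletion.exists_near k hnx (neg_ne_zero.2 h0)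
    rw [Valuation.map_neg] at hbx
    have h1 := Valuation.map_add_lt _ hax hbx
    have h2 := Valuation.map_eq_of_sub_lt _ hax
    rw [show PSF.toCompletion k a - x + (PSF.toCompletion k b - -x) =
      PSF.toCompletion k (a + b) by rw [map_add]; ring, ← h2, PSF.val_toCompletion,
      PSF.val_toCompletion] at h1
    exact absurd (PSF.val_le_val k ha (le_add_of_nonneg_right (α := PSF k) hb)) (not_le.2 h1)

instance : HasMemOrNegMem (PSFCompletion.cone k) where
  mem_or_neg_mem x := by
    have hd : DenseRange (PSF.toCompletion k) :=
      UniformSpace.Completion.denseRange_coe.comp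
        (WithVal.equiv (PSF.val k)).symm.surjective.denseRange
        (UniformSpace.Completion.continuous_coe _)
    have hx : x ∈ closure (PSF.toCompletion k '' {a | 0 ≤ a} ∪
        PSF.toCompletion k '' {a | a ≤ 0}) := by
      rw [← Set.image_union, show {a : PSF k | 0 ≤ a} ∪ {a | a ≤ 0} = Set.univ from
        Set.eq_univ_of_forall fun a => le_total 0 a, Set.image_univ]
      exact hd x
    rw [closure_union] at hx
    refine hx.imp id fun h => ?_
    refine map_mem_closure continuous_neg h ?_
    rintro _ ⟨a, ha, rfl⟩
    exact ⟨-a, neg_nonneg.2 (show a ≤ 0 from ha), map_neg _ _⟩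

open Classical in
/-- The ordering of the completion whose set of nonnegative elements is the closure of the set of
nonnegative Puiseux series. -/
noncomputable instance : LinearOrder (PSFCompletion k) :=
  LinearOrder.mkOfAddGroupCone (PSFCompletion.cone k)

instance : IsStrictOrderedRing (PSFCompletion k) :=
  haveI : IsOrderedRing (PSFCompletion k) := IsOrderedRing.mkOfCone (PSFCompletion.cone k)
  IsOrderedRing.toIsStrictOrderedRing _

theorem PSFCompletion.nonneg_iff (x : PSFCompletion k) : 0 ≤ x ↔ x ∈ PSFCompletion.nonneg k := by
  change x - 0 ∈ PSFCompletion.nonneg k ↔ _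
  rw [sub_zero]

theorem PSF.toCompletion_strictMono : StrictMono (PSF.toCompletion k) := by
  refine Monotone.strictMono_of_injective (fun a b hab => ?_) (PSF.toCompletion k).injective
  rw [← sub_nonneg, ← map_sub, PSFCompletion.nonneg_iff]
  exact subset_closure ⟨b - a, sub_nonneg.2 hab, rfl⟩

end Order

section Parts

/-- An integer part of an ordered field: a subring with `1` that has no element strictly between
`0` and `1` and that contains for each `a` some `r` with `r ≤ a < r + 1`. -/
structure IsIntegerPart {K : Type*} [Field K] [LinearOrder K] (I : Subring K) : Prop where
  discrete : ∀ r ∈ I, 0 < r → 1 ≤ r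
  exists_floor : ∀ a : K, ∃ r ∈ I, r ≤ a ∧ a < r + 1

/-- A subring `R` (not assumed to contain `1`) of a field is an additive complement of the
valuation ring `O` if `R ∩ O = {0}` and `R + O` is the whole field. -/
structure IsAdditiveComplement {K : Type*} [Field K] (R : NonUnitalSubring K)
    (O : ValuationSubring K) : Prop where
  eq_zero_of_mem : ∀ r ∈ R, r ∈ O → r = 0
  exists_add : ∀ a : K, ∃ r ∈ R, ∃ b ∈ O, a = r + b

/-- The quotient field of a subring `S` of a field `K`, formed inside `K`: the smallest subfield
that contains `S`. -/
abbrev quot {K : Type*} [Field K] (S : Set K) : Subfield K := Subfield.closure S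

/-- The subring `R + ℤ`, where `R` is a subring that need not contain `1`. -/
def addInt {K : Type*} [Field K] (R : NonUnitalSubring K) : Subring K where
  carrier := {x | ∃ r ∈ R, ∃ n : ℤ, x = r + n}
  zero_mem' := ⟨0, zero_mem R, 0, by simp⟩
  one_mem' := ⟨0, zero_mem R, 1, by simp⟩
  add_mem' := by
    rintro _ _ ⟨r, hr, m, rfl⟩ ⟨s, hs, n, rfl⟩
    exact ⟨r + s, add_mem hr hs, m + n, by push_cast; ring⟩
  neg_mem' := by
    rintro _ ⟨r, hr, m, rfl⟩
    exact ⟨-r, neg_mem hr, -m, by push_cast; ring⟩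
  mul_mem' := by
    rintro _ _ ⟨r, hr, m, rfl⟩ ⟨s, hs, n, rfl⟩
    refine ⟨r * s + n • r + m • s,
      add_mem (add_mem (mul_mem hr hs) (zsmul_mem hr n)) (zsmul_mem hs m), m * n, ?_⟩
    simp only [zsmul_eq_mul]
    push_cast
    ring

/-- The field of real algebraic numbers, with the ordering of `ℝ`. -/
abbrev RealAlg : Type := algebraicClosure ℚ ℝ


end Parts

/-! Countability rests on one observation. Series with finite support form a countable set `D`, and
every element of `L` is within value `< 1` of `D`: take the part with negative exponents, which is a
finite sum by the common denominator, and add the constant term. Distinct elements of an additive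
complement never differ by a value `< 1`; neither do those of an integer part, since value `< 1`
forces absolute value `< 1`. Choosing a nearby element of `D` is therefore injective
(`Valuation.countable_of_discrete`). Hence the quotient field is countable, whereas `L` contains all
power series with coefficients 0 and 1 and is uncountable; over a countable field, a countable
transcendence basis would make `L` countable.

Henselianity and real closedness are proved for both fields at once from
`IsLocallyCompleteWithCoeffField`: any finite set of integral elements lies in an adically complete
subring, namely `k[[t^(1/n)]]` for Puiseux series and the whole valuation ring for the completion.
Coprime factorizations of the reduction then lift. With the divisible value group, this gives
Puiseux's argument: an odd-degree polynomial is translated and scaled until its reduction is not a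
power of a linear polynomial, a factor of smaller odd degree is split off, and induction on the
degree finds a root. Square roots of units come from lifting `(X - d)(X + d)`. -/

/-! ### Lifting coprime factorizations -/

section HenselFactor

open Polynomial

/-- Over an adically complete ring, coprime monic factorizations lift from the quotient. -/
theorem Polynomial.exists_monic_mul_eq_of_isAdicComplete {A : Type*} [CommRing A] (I : Ideal A)
    [IsAdicComplete I A] [Nontrivial (A ⧸ I)] {p : A[X]} (hp : p.Monic) {f g : (A ⧸ I)[X]}
    (hf : f.Monic) (hg : g.Monic) (h : p.map (Ideal.Quotient.mk I) = f * g)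
    (hfg : IsCoprime f g) :
    ∃ F G : A[X], F.Monic ∧ G.Monic ∧ p = F * G ∧
      F.natDegree = f.natDegree ∧ G.natDegree = g.natDegree := by
  have : Nontrivial A := (Ideal.Quotient.mk I).domain_nontrivial
  have hn : p.natDegree = f.natDegree + g.natDegree := by
    rw [← hf.natDegree_mul hg, ← h, hp.natDegree_map]
  let P : MonicDegreeEq A p.natDegree := .mk p hp rfl
  let e := UniversalCoprimeFactorizationRing.homEquiv (R := A) (A ⧸ I) f.natDegree g.natDegree hn P
  let φ := e.symm ⟨(.mk f hf rfl, .mk g hg rfl), h.symm, hfg⟩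
  -- Coprime factorizations of `p` with these degrees are the points of a formally smooth algebra,
  -- so a point over `A ⧸ I` lifts to the complete ring `A`.
  obtain ⟨ψ, hψ⟩ := Algebra.FormallySmooth.exists_mkₐ_comp_eq_of_isAdicComplete φ
  obtain ⟨⟨F, G⟩, hFG, -⟩ :=
    UniversalCoprimeFactorizationRing.homEquiv (R := A) A f.natDegree g.natDegree hn P ψ
  refine ⟨F.1, G.1, F.monic, G.monic, ?_, F.natDegree, G.natDegree⟩
  simpa [P] using hFG.symm

end HenselFactor

/-! ### Hensel's lemma from locally complete subrings -/

section CoefficientField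

open Polynomial

variable {k K : Type u} [Field k] [Field K] {Γ : Type*} [LinearOrderedCommGroupWithZero Γ]

/-- `ι` embeds `k` as a field of representatives for the residue field of `v`, and finitely many
integral elements always lie in a subring of the valuation ring that contains the image of `ι` and
is adically complete with respect to an element that divides all the given nonunits. -/
structure IsLocallyCompleteWithCoeffField (v : Valuation K Γ) (ι : k →+* K) : Prop where
  map_le_one : ∀ c, v (ι c) ≤ 1
  exists_residue : ∀ x, v x ≤ 1 → ∃ c, v (x - ι c) < 1
  exists_isAdicComplete : ∀ s : Finset K, (∀ x ∈ s, v x ≤ 1) →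
    ∃ (A : Type u) (_ : CommRing A) (φ : A →+* K) (j : k →+* A) (π : A),
      Function.Injective φ ∧ φ.comp j = ι ∧ IsAdicComplete (Ideal.span {π}) A ∧
      (∀ a, v (φ a) ≤ 1) ∧ v (φ π) < 1 ∧ ∀ x ∈ s, ∃ a, φ a = x ∧ (v x < 1 → π ∣ a)

variable {v : Valuation K Γ} {ι : k →+* K}

namespace IsLocallyCompleteWithCoeffField

theorem map_eq_one (H : IsLocallyCompleteWithCoeffField v ι) {c : k} (hc : c ≠ 0) :
    v (ι c) = 1 := by
  refine le_antisymm (H.map_le_one c) ?_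
  have h := H.map_le_one c⁻¹
  rw [map_inv₀, map_inv₀] at h
  have h0 : v (ι c) ≠ 0 := by simpa using hc
  exact (inv_le_one₀ (zero_lt_iff.2 h0)).1 h

theorem eq_zero_of_map_lt_one (H : IsLocallyCompleteWithCoeffField v ι) {c : k}
    (hc : v (ι c) < 1) : c = 0 := by
  by_contra h
  exact hc.ne (H.map_eq_one h)

/-- A lifting problem involves finitely many elements, so it descends to a complete subring `A`. -/
theorem henselianLocalRing (H : IsLocallyCompleteWithCoeffField v ι) :
    HenselianLocalRing v.valuationSubring where
  is_henselian := by
    classical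
    intro f hf a₀ h₀ hu
    obtain ⟨u, hu⟩ := hu.exists_right_inv
    let O := v.valuationSubring
    -- The inverse `u` of `f'(a₀)` is included so that the derivative is still a unit in `A`, and
    -- `f(a₀)` so that `π` divides it.
    let s : Finset K := insert (a₀ : K) (insert ((f.eval a₀ : O) : K) (insert (u : K)
      ((Finset.range (f.natDegree + 1)).image fun i => ((f.coeff i : O) : K))))
    obtain ⟨A, _, φ, j, π, hφ, -, hA, hle, hπ, hs⟩ := H.exists_isAdicComplete s (by
      intro x hx
      simp only [s, Finset.mem_insert, Finset.mem_image] at hx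
      rcases hx with rfl | rfl | rfl | ⟨i, -, rfl⟩
      exacts [a₀.2, (f.eval a₀).2, u.2, (f.coeff i).2])
    let ψ : A →+* O := φ.codRestrict O.toSubring hle
    have hψ : Function.Injective ψ := fun a b hab => hφ (congrArg Subtype.val hab)
    have hlift : ∀ x : O, (x : K) ∈ s → ∃ a, ψ a = x ∧ (v x < 1 → π ∣ a) := by
      intro x hx
      obtain ⟨a, ha, h⟩ := hs x hx
      exact ⟨a, Subtype.ext ha, h⟩
    obtain ⟨F, hF⟩ : f ∈ Polynomial.lifts ψ := by
      rw [Polynomial.lifts_iff_coeff_lifts]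
      intro i
      by_cases hi : i < f.natDegree + 1
      · obtain ⟨a, ha, -⟩ := hlift (f.coeff i) (by
          simp only [s, Finset.mem_insert, Finset.mem_image]
          exact .inr (.inr (.inr ⟨i, Finset.mem_range.2 hi, rfl⟩)))
        exact ⟨a, ha⟩
      · exact ⟨0, by rw [map_zero, Polynomial.coeff_eq_zero_of_natDegree_lt (not_lt.1 hi)]⟩
    rw [Polynomial.coe_mapRingHom] at hF
    obtain ⟨b₀, hb₀, -⟩ := hlift a₀ (by simp [s])
    obtain ⟨w, hw, -⟩ := hlift u (by simp [s])
    obtain ⟨y, hy, hπy⟩ := hlift (f.eval a₀) (by simp [s])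
    have hFm : F.Monic := Polynomial.monic_of_injective hψ (hF ▸ hf)
    have hy' : F.eval b₀ = y := hψ (by rw [hy, ← hF, ← hb₀, Polynomial.eval_map_apply])
    obtain ⟨b, hb, hb'⟩ := HenselianRing.is_henselian (I := Ideal.span {π}) F hFm b₀
      (by rw [hy', Ideal.mem_span_singleton]
          exact hπy ((Valuation.mem_maximalIdeal_iff K v).1 h₀))
      (by
        have : IsUnit (F.derivative.eval b₀) := by
          refine IsUnit.of_mul_eq_one w (hψ ?_)
          rw [map_mul, hw, map_one, ← hu, ← hF, Polynomial.derivative_map, ← hb₀,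
            Polynomial.eval_map_apply]
        exact this.map _)
    refine ⟨ψ b, ?_, ?_⟩
    · rw [Polynomial.IsRoot, ← hF, Polynomial.eval_map_apply, hb.eq_zero, map_zero]
    · obtain ⟨c, hc⟩ := Ideal.mem_span_singleton.1 hb'
      rw [Valuation.mem_maximalIdeal_iff, ← hb₀, ← map_sub, hc]
      change v (φ (π * c)) < 1
      rw [map_mul, map_mul]
      exact mul_lt_one_of_lt_of_le hπ (hle c)

/-- In a complete subring where `π` divides every coefficient of `f - gh`, the factorization holds
modulo `π` and lifts. -/
theorem exists_mul_eq (H : IsLocallyCompleteWithCoeffField v ι) {f : K[X]} (hf : f.Monic)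
    {g h : k[X]} (hg : g.Monic) (hh : h.Monic) (hgh : IsCoprime g h)
    (hle : ∀ i, v (f.coeff i) ≤ 1) (hlt : ∀ i, v ((f - (g * h).map ι).coeff i) < 1) :
    ∃ F G : K[X], F.Monic ∧ G.Monic ∧ f = F * G ∧
      F.natDegree = g.natDegree ∧ G.natDegree = h.natDegree := by
  classical
  let r := f - (g * h).map ι
  obtain ⟨A, _, φ, j, π, hφ, hj, hA, hφle, hπ, hs⟩ := H.exists_isAdicComplete
    (f.support.image f.coeff ∪ r.support.image r.coeff) (by
      intro x hx
      simp only [Finset.mem_union, Finset.mem_image] at hx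
      rcases hx with ⟨i, -, rfl⟩ | ⟨i, -, rfl⟩
      exacts [hle i, (hlt i).le])
  obtain ⟨F, hF⟩ : f ∈ Polynomial.lifts φ := by
    rw [Polynomial.lifts_iff_coeff_lifts]
    intro i
    by_cases hi : i ∈ f.support
    · obtain ⟨a, ha, -⟩ := hs (f.coeff i)
        (Finset.mem_union_left _ (Finset.mem_image_of_mem _ hi))
      exact ⟨a, ha⟩
    · exact ⟨0, by rw [map_zero, Polynomial.notMem_support_iff.1 hi]⟩
  rw [Polynomial.coe_mapRingHom] at hF
  have hdvd : ∀ i, π ∣ (F - (g * h).map j).coeff i := by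
    intro i
    have hi' : φ ((F - (g * h).map j).coeff i) = r.coeff i := by
      rw [← Polynomial.coeff_map, Polynomial.map_sub, Polynomial.map_map, hF, hj]
    by_cases hi : i ∈ r.support
    · obtain ⟨a, ha, h⟩ := hs (r.coeff i)
        (Finset.mem_union_right _ (Finset.mem_image_of_mem _ hi))
      rw [hφ (hi'.trans ha.symm)]
      exact h (hlt i)
    · rw [Polynomial.notMem_support_iff.1 hi, ← map_zero φ] at hi'
      rw [hφ hi']
      exact dvd_zero π
  have hntr : Nontrivial (A ⧸ Ideal.span {π}) := by
    refine Ideal.Quotient.nontrivial_iff.2 fun htop => ?_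
    obtain ⟨c, hc⟩ := Ideal.mem_span_singleton.1 ((Ideal.eq_top_iff_one _).1 htop)
    have h1 : v (φ (π * c)) < 1 := by
      rw [map_mul, map_mul]
      exact mul_lt_one_of_lt_of_le hπ (hφle c)
    rw [← hc, map_one, map_one] at h1
    exact lt_irrefl _ h1
  let q := Ideal.Quotient.mk (Ideal.span {π})
  obtain ⟨P, Q, hP, hQ, hPQ, hPd, hQd⟩ :=
    Polynomial.exists_monic_mul_eq_of_isAdicComplete (Ideal.span {π})
      (Polynomial.monic_of_injective hφ (hF ▸ hf))
      (hg.map (q.comp j)) (hh.map (q.comp j))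
      (by
        rw [← Polynomial.map_mul, ← Polynomial.map_map, ← sub_eq_zero, ← Polynomial.map_sub]
        ext i
        rw [Polynomial.coeff_map, Polynomial.coeff_zero, Ideal.Quotient.eq_zero_iff_mem,
          Ideal.mem_span_singleton]
        exact hdvd i)
      (by simpa using hgh.map (Polynomial.mapRingHom (q.comp j)))
  refine ⟨P.map φ, Q.map φ, hP.map φ, hQ.map φ, ?_, ?_, ?_⟩
  · rw [← Polynomial.map_mul, ← hPQ, hF]
  · rw [hP.natDegree_map, hPd, hg.natDegree_map]
  · rw [hQ.natDegree_map, hQd, hh.natDegree_map]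

end IsLocallyCompleteWithCoeffField

end CoefficientField

/-! ### Puiseux's argument for real closedness -/

section RealClosed

open Polynomial

/-- Dividing out a root of even multiplicity keeps the degree odd and does not affect the
multiplicities of the other roots. -/
theorem IsRealClosed.exists_odd_rootMultiplicity {k : Type*} [Field k] [IsRealClosed k] {f : k[X]}
    (hf : Odd f.natDegree) : ∃ c, Odd (f.rootMultiplicity c) := by
  induction hn : f.natDegree using Nat.strong_induction_on generalizing f with
  | _ n ih =>
    obtain ⟨c, hc⟩ := IsRealClosed.exists_isRoot_of_odd_natDegree hf
    have hf0 : f ≠ 0 := by rintro rfl; simp at hf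
    by_cases hm : Odd (f.rootMultiplicity c)
    · exact ⟨c, hm⟩
    obtain ⟨g, hg, hgc⟩ := exists_eq_pow_rootMultiplicity_mul_and_not_dvd f hf0 c
    have hg0 : g ≠ 0 := by rintro rfl; simp at hgc
    have hpos : 0 < f.rootMultiplicity c := (rootMultiplicity_pos hf0).2 hc
    have hdeg : f.natDegree = f.rootMultiplicity c + g.natDegree := by
      conv_lhs => rw [hg]
      rw [natDegree_mul (pow_ne_zero _ (X_sub_C_ne_zero c)) hg0, natDegree_pow, natDegree_X_sub_C,
        mul_one]
    have hodd : Odd g.natDegree := by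
      rw [hdeg, Nat.odd_add] at hf
      by_contra h
      exact hm (hf.2 (Nat.not_odd_iff_even.1 h))
    obtain ⟨d, hd⟩ := ih _ (by lia) hodd rfl
    have hdc : d ≠ c := by
      rintro rfl
      have : g.rootMultiplicity d = 0 :=
        rootMultiplicity_eq_zero fun h => hgc (dvd_iff_isRoot.2 h)
      rw [this] at hd
      exact absurd hd (by simp)
    refine ⟨d, ?_⟩
    rw [hg, rootMultiplicity_mul (by rw [← hg]; exact hf0), rootMultiplicity_eq_zero, zero_add]
    · exact hd
    · rw [IsRoot, eval_pow, eval_sub, eval_X, eval_C]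
      exact pow_ne_zero _ (sub_ne_zero.2 hdc)

/-- The translation that removes the second coefficient of a monic polynomial. -/
theorem Polynomial.Monic.coeff_taylor_natDegree_sub_one {K : Type*} [Field K] [CharZero K]
    {f : K[X]} (hf : f.Monic) (h : 0 < f.natDegree) :
    (taylor (-(f.coeff (f.natDegree - 1) / f.natDegree)) f).coeff (f.natDegree - 1) = 0 := by
  have hn0 : (f.natDegree : K) ≠ 0 := by exact_mod_cast h.ne'
  have hd : (hasseDeriv (f.natDegree - 1) f).natDegree ≤ 1 :=
    (natDegree_hasseDeriv_le f _).trans (by lia)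
  have h1 : 1 + (f.natDegree - 1) = f.natDegree := by lia
  rw [taylor_coeff, eq_X_add_C_of_natDegree_le_one hd, hasseDeriv_coeff, hasseDeriv_coeff, h1,
    zero_add, Nat.choose_self, Nat.choose_symm h, Nat.choose_one_right,
    hf.coeff_natDegree]
  simp
  field_simp
  ring

variable {k K : Type u} [Field k] [Field K] {Γ : Type*} [LinearOrderedCommGroupWithZero Γ]
  {v : Valuation K Γ} {ι : k →+* K}

namespace IsLocallyCompleteWithCoeffField

theorem exists_reduction (H : IsLocallyCompleteWithCoeffField v ι) {f : K[X]} (hf : f.Monic)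
    (hle : ∀ i, v (f.coeff i) ≤ 1) :
    ∃ g : k[X], g.Monic ∧ g.natDegree = f.natDegree ∧ ∀ i, v ((f - g.map ι).coeff i) < 1 := by
  choose c hc using fun i => H.exists_residue _ (hle i)
  -- Residues are used only below the top degree; the leading coefficient is set to 1, so the degree
  -- is preserved.
  let r : k[X] := ∑ i ∈ Finset.range f.natDegree, monomial i (c i)
  have hr : ∀ i, r.coeff i = if i < f.natDegree then c i else 0 := by
    intro i
    simp [r, finsetSum_coeff, coeff_monomial]
  have hdeg : r.degree < (f.natDegree : WithBot ℕ) := by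
    rw [degree_lt_iff_coeff_zero]
    intro i hi
    rw [hr, if_neg (not_lt.2 hi)]
  refine ⟨X ^ f.natDegree + r, monic_X_pow_add hdeg, by
      rw [natDegree_add_eq_left_of_degree_lt (by rwa [degree_X_pow]), natDegree_X_pow], fun i => ?_⟩
  rw [coeff_sub, coeff_map, coeff_add, coeff_X_pow, hr]
  rcases lt_trichotomy i f.natDegree with h | h | h
  · simpa [h, h.ne] using hc i
  · subst h
    simp [hf.coeff_natDegree]
  · simp [h.ne', h.not_gt, coeff_eq_zero_of_natDegree_lt h]

/-- A monic integral polynomial of odd degree whose second coefficient vanishes and that does not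
reduce to a power of `X` has a proper monic factor of odd degree. -/
theorem exists_odd_factor [CharZero k] [IsRealClosed k]
    (H : IsLocallyCompleteWithCoeffField v ι) {f : K[X]} (hf : f.Monic) (hodd : Odd f.natDegree)
    (hle : ∀ i, v (f.coeff i) ≤ 1) (hsnd : f.coeff (f.natDegree - 1) = 0) {i : ℕ}
    (hi : i < f.natDegree) (hunit : v (f.coeff i) = 1) :
    ∃ F G : K[X], F.Monic ∧ f = F * G ∧ Odd F.natDegree ∧ F.natDegree < f.natDegree := by
  obtain ⟨g, hg, hgd, hfg⟩ := H.exists_reduction hf hle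
  obtain ⟨c, hc⟩ := IsRealClosed.exists_odd_rootMultiplicity (hgd ▸ hodd)
  obtain ⟨h, hgh, hdvd⟩ := exists_eq_pow_rootMultiplicity_mul_and_not_dvd g hg.ne_zero c
  set m := g.rootMultiplicity c with hm
  have hpow : ((X - C c) ^ m : k[X]).Monic := (monic_X_sub_C c).pow m
  have hh : h.Monic := hpow.of_mul_monic_left (hgh ▸ hg)
  have hpd : ((X - C c) ^ m : k[X]).natDegree = m := by
    rw [natDegree_pow, natDegree_X_sub_C, mul_one]
  have hadd : g.natDegree = m + h.natDegree := by
    conv_lhs => rw [hgh]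
    rw [hpow.natDegree_mul hh, hpd]
  have hcop : IsCoprime ((X - C c) ^ m) h :=
    ((irreducible_X_sub_C c).coprime_iff_not_dvd.2 hdvd).pow_left
  obtain ⟨F, G, hF, hG, hFG, hFd, hGd⟩ :=
    H.exists_mul_eq hf hpow hh hcop hle (by rw [← hgh]; exact hfg)
  rw [hpd] at hFd
  refine ⟨F, G, hF, hFG, hFd ▸ hc, ?_⟩
  rw [hFd, ← hgd, hadd]
  -- If `h` were constant, the reduction would be `(X - c)^m`. Its second coefficient `-mc`
  -- vanishes, so `c = 0` in characteristic zero, and the reduction `X^m` contradicts the unit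
  -- coefficient at `i`.
  refine Nat.lt_add_of_pos_right (Nat.pos_of_ne_zero fun h0 => ?_)
  have hh1 : h = 1 := hh.natDegree_eq_zero.1 h0
  have hgm : g.natDegree = m := by rw [hadd, h0, add_zero]
  rw [hh1, mul_one] at hgh
  have hmpos : 0 < m := hc.pos
  have h1 : g.coeff (g.natDegree - 1) = 0 := by
    refine H.eq_zero_of_map_lt_one ?_
    have := hfg (f.natDegree - 1)
    rwa [coeff_sub, hsnd, zero_sub, Valuation.map_neg, coeff_map, ← hgd] at this
  have h2 : g.coeff (g.natDegree - 1) = -(m * c) := by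
    have h3 : g.nextCoeff = -(m * c) := by
      rw [hgh, (monic_X_sub_C c).nextCoeff_pow, nextCoeff_X_sub_C, nsmul_eq_mul, mul_neg]
    rwa [nextCoeff_of_natDegree_pos (by lia)] at h3
  have hc0 : c = 0 := by
    rw [h1, eq_comm, neg_eq_zero, mul_eq_zero] at h2
    exact h2.resolve_left (by exact_mod_cast hmpos.ne')
  have h4 := hfg i
  rw [hgh, hc0, C_0, sub_zero, coeff_sub, coeff_map, coeff_X_pow, if_neg (by lia), map_zero,
    sub_zero, hunit] at h4
  exact lt_irrefl _ h4

theorem exists_isRoot_of_odd [CharZero k] [IsRealClosed k]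
    (H : IsLocallyCompleteWithCoeffField v ι)
    (hdiv : ∀ x : K, ∀ n : ℕ, n ≠ 0 → ∃ y, v y ^ n = v x) {f : K[X]} (hodd : Odd f.natDegree) :
    ∃ x, f.IsRoot x := by
  have : CharZero K := charZero_of_injective_ringHom ι.injective
  induction hn : f.natDegree using Nat.strong_induction_on generalizing f with
  | _ n ih =>
    subst hn
    wlog hf : f.Monic generalizing f
    · have hf0 : f ≠ 0 := by rintro rfl; simp at hodd
      have hdeg : (f * C f.leadingCoeff⁻¹).natDegree = f.natDegree :=
        natDegree_mul_leadingCoeff_inv f hf0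
      obtain ⟨x, hx⟩ := this (f := f * C f.leadingCoeff⁻¹) (by rwa [hdeg])
        (by rw [hdeg]; exact ih) (monic_mul_leadingCoeff_inv hf0)
      refine ⟨x, ?_⟩
      rw [IsRoot, eval_mul, eval_C, mul_eq_zero] at hx
      exact hx.resolve_right (inv_ne_zero (leadingCoeff_ne_zero.2 hf0))
    wlog hsnd : f.coeff (f.natDegree - 1) = 0 generalizing f
    · let a := -(f.coeff (f.natDegree - 1) / f.natDegree)
      have hdeg : (taylor a f).natDegree = f.natDegree := natDegree_taylor f a
      obtain ⟨x, hx⟩ := this (f := taylor a f) (by rwa [hdeg]) (by rw [hdeg]; exact ih)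
        (by rwa [Monic, leadingCoeff_taylor])
        (by rw [hdeg]; exact hf.coeff_taylor_natDegree_sub_one hodd.pos)
      exact ⟨x + a, by rwa [IsRoot, taylor_eval] at hx⟩
    by_cases hz : ∀ i < f.natDegree, f.coeff i = 0
    · have hX : f = X ^ f.natDegree := by
        ext i
        rw [coeff_X_pow]
        rcases lt_trichotomy i f.natDegree with h | h | h
        · rw [hz i h, if_neg h.ne]
        · rw [if_pos h, h, hf.coeff_natDegree]
        · rw [coeff_eq_zero_of_natDegree_lt h, if_neg h.ne']
      exact ⟨0, by rw [hX, IsRoot, eval_pow, eval_X, zero_pow hodd.pos.ne']⟩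
    push Not at hz
    obtain ⟨i₀, hi₀, hi₀'⟩ := hz
    -- Scaling the roots by `s` multiplies the coefficient at `i` by `s^(n-i)`. With `s` the inverse
    -- of the `r i` of largest value, all coefficients become integral and the one at `i` has value
    -- 1.
    choose! r hr using fun i (hi : i < f.natDegree) =>
      hdiv (f.coeff i) (f.natDegree - i) (Nat.sub_ne_zero_of_lt hi)
    obtain ⟨i, hi, hmax⟩ := Finset.exists_max_image (Finset.range f.natDegree) (fun i => v (r i))
      ⟨i₀, Finset.mem_range.2 hi₀⟩
    rw [Finset.mem_range] at hi
    have hri : r i ≠ 0 := by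
      intro h0
      have h1 := hmax i₀ (Finset.mem_range.2 hi₀)
      rw [h0, map_zero, le_zero_iff] at h1
      have h2 := hr i₀ hi₀
      rw [h1, zero_pow (Nat.sub_ne_zero_of_lt hi₀), eq_comm, map_eq_zero] at h2
      exact hi₀' h2
    have hvi : 0 < v (r i) := zero_lt_iff.2 (by simpa using hri)
    let g := scaleRoots f (r i)⁻¹
    have hgd : g.natDegree = f.natDegree := natDegree_scaleRoots _ _
    have hg : g.Monic := (monic_scaleRoots_iff _).2 hf
    have hgc : ∀ j < f.natDegree,
        v (g.coeff j) = v (r j) ^ (f.natDegree - j) * (v (r i) ^ (f.natDegree - j))⁻¹ := by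
      intro j hj
      rw [coeff_scaleRoots, map_mul, map_pow, map_inv₀, inv_pow, hr j hj]
    obtain ⟨F, G, hF, hFG, hFodd, hFlt⟩ := H.exists_odd_factor hg (hgd ▸ hodd) (i := i)
      (by
        intro j
        rcases lt_trichotomy j f.natDegree with h | h | h
        · rw [hgc j h, ← div_eq_mul_inv, div_le_one₀ (pow_pos hvi _)]
          exact pow_le_pow_left₀ zero_le (hmax j (Finset.mem_range.2 h)) _
        · rw [h, ← hgd, hg.coeff_natDegree, map_one]
        · rw [coeff_eq_zero_of_natDegree_lt (hgd ▸ h), map_zero]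
          exact zero_le_one)
      (by rw [hgd, coeff_scaleRoots, hsnd, zero_mul]) (hgd ▸ hi)
      (by rw [hgc i hi, mul_inv_cancel₀ (pow_pos hvi _).ne'])
    obtain ⟨y, hy⟩ := ih _ (hgd ▸ hFlt) hFodd rfl
    have hgy : g.eval y = 0 := by rw [hFG, eval_mul, hy.eq_zero, zero_mul]
    refine ⟨r i * y, ?_⟩
    have h1 := scaleRoots_eval_mul f (r i * y) (r i)⁻¹
    rw [inv_mul_cancel_left₀ hri, hgy, eq_comm, mul_eq_zero] at h1
    exact h1.resolve_left (pow_ne_zero _ (inv_ne_zero hri))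

/-- `X² - u` reduces to `(X - d)(X + d)`, coprime because `2d ≠ 0`; a lifted linear factor gives the
square root. -/
theorem isSquare_of_residue [CharZero k] (H : IsLocallyCompleteWithCoeffField v ι) {u : K} {d : k}
    (hd : d ≠ 0) (h : v (u - ι (d * d)) < 1) : IsSquare u := by
  have hu : v u ≤ 1 := by
    have := v.map_add (u - ι (d * d)) (ι (d * d))
    rw [sub_add_cancel] at this
    exact this.trans (max_le h.le (H.map_le_one _))
  have hcop : IsCoprime (X - C d) (X - C (-d)) := by
    refine isCoprime_X_sub_C_of_isUnit_sub (IsUnit.mk0 _ ?_)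
    rw [sub_neg_eq_add, ← two_mul]
    exact mul_ne_zero two_ne_zero hd
  have hmul : (X - C d) * (X - C (-d)) = X ^ 2 - C (d * d) := by
    rw [C_neg, C_mul]; ring
  obtain ⟨F, G, hF, -, hFG, hFd, -⟩ := H.exists_mul_eq (f := X ^ 2 - C u)
    (monic_X_pow_sub_C u two_ne_zero) (monic_X_sub_C d) (monic_X_sub_C (-d)) hcop
    (by
      intro i
      rw [coeff_sub, coeff_X_pow, coeff_C]
      rcases i with _ | i
      · simpa using hu
      · by_cases hi : i + 1 = 2 <;> simp [hi])
    (by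
      intro i
      rw [hmul, Polynomial.map_sub, Polynomial.map_pow, map_X, map_C, sub_sub_sub_cancel_left,
        ← C_sub, coeff_C]
      split_ifs
      · rwa [Valuation.map_sub_swap]
      · simp)
  have hF1 : F.degree = 1 := by
    rw [degree_eq_natDegree hF.ne_zero, hFd, natDegree_X_sub_C, Nat.cast_one]
  obtain ⟨x, hx⟩ := exists_root_of_degree_eq_one hF1
  refine ⟨x, ?_⟩
  have h0 : (X ^ 2 - C u).eval x = 0 := by rw [hFG, eval_mul, hx.eq_zero, zero_mul]
  simp only [eval_sub, eval_pow, eval_X, eval_C] at h0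
  rw [← pow_two]
  exact (sub_eq_zero.1 h0).symm

theorem isRealClosed [CharZero k] [IsRealClosed k] [IsSemireal K]
    (H : IsLocallyCompleteWithCoeffField v ι)
    (hdiv : ∀ x : K, ∀ n : ℕ, n ≠ 0 → ∃ y, v y ^ n = v x) : IsRealClosed K where
  exists_isRoot_of_odd_natDegree hf := H.exists_isRoot_of_odd hdiv hf
  isSquare_or_isSquare_neg x := by
    rcases eq_or_ne x 0 with rfl | hx
    · exact .inl IsSquare.zero
    obtain ⟨r, hr⟩ := hdiv x 2 two_ne_zero
    have hvx : v x ≠ 0 := by simpa using hx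
    -- Modulo the square `r²`, `x` is a unit with nonzero residue `c`, and `c` or `-c` is a square
    -- in `k`.
    have hr0 : r ≠ 0 := by
      rintro rfl
      exact hvx (by rw [← hr, map_zero, zero_pow two_ne_zero])
    have hu : v (x / (r * r)) = 1 := by
      rw [map_div₀, map_mul, ← pow_two, hr, div_self hvx]
    obtain ⟨c, hc⟩ := H.exists_residue _ hu.le
    have hc0 : c ≠ 0 := by
      rintro rfl
      rw [map_zero, sub_zero, hu] at hc
      exact lt_irrefl _ hc
    have hrr : x / (r * r) * (r * r) = x := div_mul_cancel₀ _ (mul_ne_zero hr0 hr0)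
    rcases IsRealClosed.isSquare_or_isSquare_neg c with ⟨d, hd⟩ | ⟨d, hd⟩
    · left
      rw [← hrr]
      refine (H.isSquare_of_residue (d := d) ?_ (hd ▸ hc)).mul ⟨r, rfl⟩
      rintro rfl
      exact hc0 (by rw [hd, mul_zero])
    · right
      rw [← hrr, ← neg_mul]
      refine (H.isSquare_of_residue (d := d) ?_ ?_).mul ⟨r, rfl⟩
      · rintro rfl
        exact hc0 (by rw [← neg_eq_zero, hd, mul_zero])
      · rw [← hd, map_neg, ← neg_add', Valuation.map_neg, ← sub_eq_add_neg]
        exact hc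

end IsLocallyCompleteWithCoeffField

end RealClosed

/-! ### Puiseux series and their power series subrings -/

section Puiseux

variable (k : Type u) [Field k]

variable {k} in
theorem PSF.ext {a b : PSF k} (h : ∀ q, (PSF.toHahn k a).coeff q = (PSF.toHahn k b).coeff q) :
    a = b :=
  PSF.toHahn_injective k (HahnSeries.ext (funext h))

theorem PSF.exists_support_subset (a : PSF k) :
    ∃ n : ℕ+, ∀ q ∈ (PSF.toHahn k a).support, ∃ m : ℤ, q = (m : ℚ) / (n : ℚ) := by
  obtain ⟨n, hn⟩ := Set.mem_iUnion.1 a.2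
  exact ⟨n, (mem_laurentEmb_range_iff k n _).1 hn⟩

/-- A Hahn series whose exponents have a common denominator, as a Puiseux series. -/
noncomputable def PSF.mk (x : HahnSeries ℚ k) (n : ℕ+)
    (h : ∀ q ∈ x.support, ∃ m : ℤ, q = (m : ℚ) / (n : ℚ)) : PSF k :=
  ⟨x, Set.mem_iUnion.2 ⟨n, (mem_laurentEmb_range_iff k n x).2 h⟩⟩

theorem PSF.toHahn_mk (x : HahnSeries ℚ k) (n : ℕ+)
    (h : ∀ q ∈ x.support, ∃ m : ℤ, q = (m : ℚ) / (n : ℚ)) : PSF.toHahn k (PSF.mk k x n h) = x :=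
  rfl

/-- The monomial `c t^g`. -/
noncomputable def PSF.monomial (g : ℚ) (c : k) : PSF k :=
  PSF.mk k (HahnSeries.single g c) ⟨g.den, g.den_pos⟩ fun q hq => by
    rw [HahnSeries.support_single_subset hq]
    exact ⟨g.num, (Rat.num_div_den g).symm⟩

theorem PSF.toHahn_monomial (g : ℚ) (c : k) :
    PSF.toHahn k (PSF.monomial k g c) = HahnSeries.single g c := rfl

/-- The embedding of the coefficient field in the Puiseux series field. -/
noncomputable def PSF.const : k →+* PSF k :=
  (HahnSeries.C : k →+* HahnSeries ℚ k).codRestrict (puiseuxSubfield k).toSubring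
    fun c => (PSF.monomial k 0 c).2

theorem PSF.toHahn_const (c : k) : PSF.toHahn k (PSF.const k c) = HahnSeries.single 0 c := rfl

theorem PSF.val_le_one_iff (a : PSF k) :
    PSF.val k a ≤ 1 ↔ ∀ q < 0, (PSF.toHahn k a).coeff q = 0 := by
  rw [← map_one (PSF.val k), PSF.val_le_iff, map_one, HahnSeries.orderTop_one,
    HahnSeries.le_orderTop_iff_forall]
  simp

theorem PSF.val_lt_one_iff (a : PSF k) :
    PSF.val k a < 1 ↔ ∀ q ≤ 0, (PSF.toHahn k a).coeff q = 0 := by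
  rw [← map_one (PSF.val k), ← not_le, PSF.val_le_iff, map_one, HahnSeries.orderTop_one, not_le]
  constructor
  · intro h q hq
    refine HahnSeries.coeff_eq_zero_of_lt_orderTop (lt_of_le_of_lt ?_ h)
    exact_mod_cast hq
  · intro h
    by_contra hcon
    rw [not_lt] at hcon
    obtain ⟨g, hg⟩ := WithTop.ne_top_iff_exists.1 (ne_top_of_le_ne_top (WithTop.coe_ne_top) hcon)
    exact HahnSeries.coeff_orderTop_ne hg.symm (h g (by rw [← hg] at hcon; exact_mod_cast hcon))

theorem PSF.exists_val_pow_eq (a : PSF k) (n : ℕ) (hn : n ≠ 0) :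
    ∃ b, PSF.val k b ^ n = PSF.val k a := by
  rcases eq_or_ne a 0 with rfl | ha
  · exact ⟨0, by rw [map_zero, zero_pow hn]⟩
  have ha' : PSF.toHahn k a ≠ 0 := (map_ne_zero _).2 ha
  refine ⟨PSF.monomial k ((PSF.toHahn k a).order / n) 1, ?_⟩
  have h : (PSF.toHahn k (PSF.monomial k ((PSF.toHahn k a).order / n) 1 ^ n)).orderTop =
      (PSF.toHahn k a).orderTop := by
    rw [map_pow, PSF.toHahn_monomial, HahnSeries.single_pow, one_pow,
      HahnSeries.orderTop_single one_ne_zero, nsmul_eq_mul,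
      mul_div_cancel₀ _ (by exact_mod_cast hn), HahnSeries.order_eq_orderTop_of_ne_zero ha']
  rw [← map_pow]
  exact le_antisymm ((PSF.val_le_iff k _ _).2 h.ge) ((PSF.val_le_iff k _ _).2 h.le)

/-- The additive embedding `m ↦ m / n` of `ℕ` into `ℚ`. -/
def natDivHom (n : ℕ+) : ℕ →+ ℚ := (divHom n).comp (Nat.castAddMonoidHom ℤ)

theorem natDivHom_le_iff (n : ℕ+) (a b : ℕ) : natDivHom n a ≤ natDivHom n b ↔ a ≤ b :=
  (divHom_le_iff n a b).trans Nat.cast_le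

theorem natDivHom_injective (n : ℕ+) : Function.Injective (natDivHom n) :=
  (divHom_injective n).comp Nat.cast_injective

/-- The embedding of `k[[t]]` in the Puiseux series field that sends `t` to `t^(1/n)`. -/
noncomputable def PSF.ofPowerSeries (n : ℕ+) : PowerSeries k →+* PSF k :=
  ((HahnSeries.embDomainRingHom (natDivHom n) (natDivHom_injective n)
    (natDivHom_le_iff n)).comp HahnSeries.toPowerSeries.symm.toRingHom).codRestrict
    (puiseuxSubfield k).toSubring fun z => Set.mem_iUnion.2 ⟨n, by
      refine (mem_laurentEmb_range_iff k n _).2 fun q hq => ?_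
      by_contra hcon
      refine hq (HahnSeries.embDomain_of_notMem_range ?_)
      rintro ⟨m, rfl⟩
      exact hcon ⟨m, rfl⟩⟩

theorem PSF.coeff_ofPowerSeries (n : ℕ+) (z : PowerSeries k) (m : ℕ) :
    (PSF.toHahn k (PSF.ofPowerSeries k n z)).coeff (natDivHom n m) = PowerSeries.coeff m z :=
  HahnSeries.embDomain_coeff (a := m)

theorem PSF.coeff_ofPowerSeries_of_notMem (n : ℕ+) (z : PowerSeries k) {q : ℚ}
    (hq : q ∉ Set.range (natDivHom n)) :
    (PSF.toHahn k (PSF.ofPowerSeries k n z)).coeff q = 0 :=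
  HahnSeries.embDomain_of_notMem_range hq

theorem PSF.ofPowerSeries_injective (n : ℕ+) : Function.Injective (PSF.ofPowerSeries k n) := by
  intro y z h
  ext m
  rw [← PSF.coeff_ofPowerSeries, h, PSF.coeff_ofPowerSeries]

theorem PSF.ofPowerSeries_C (n : ℕ+) (c : k) :
    PSF.ofPowerSeries k n (PowerSeries.C c) = PSF.const k c := by
  refine PSF.ext fun q => ?_
  rw [PSF.toHahn_const]
  by_cases hq : q ∈ Set.range (natDivHom n)
  · obtain ⟨m, rfl⟩ := hq
    rw [PSF.coeff_ofPowerSeries, PowerSeries.coeff_C]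
    rcases eq_or_ne m 0 with rfl | hm
    · rw [map_zero, HahnSeries.coeff_single_same, if_pos rfl]
    · rw [if_neg hm, HahnSeries.coeff_single_of_ne]
      rwa [Ne, ← map_zero (natDivHom n), (natDivHom_injective n).eq_iff]
  · rw [PSF.coeff_ofPowerSeries_of_notMem k n _ hq, HahnSeries.coeff_single_of_ne]
    rintro rfl
    exact hq ⟨0, map_zero _⟩

theorem natDivHom_nonneg (n : ℕ+) (m : ℕ) : 0 ≤ natDivHom n m := by
  rw [← map_zero (natDivHom n), natDivHom_le_iff]
  exact m.zero_le

theorem PSF.val_ofPowerSeries_le_one (n : ℕ+) (z : PowerSeries k) :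
    PSF.val k (PSF.ofPowerSeries k n z) ≤ 1 := by
  rw [PSF.val_le_one_iff]
  intro q hq
  refine PSF.coeff_ofPowerSeries_of_notMem k n z ?_
  rintro ⟨m, rfl⟩
  exact absurd (natDivHom_nonneg n m) (not_le.2 hq)

theorem PSF.val_ofPowerSeries_lt_one_iff (n : ℕ+) (z : PowerSeries k) :
    PSF.val k (PSF.ofPowerSeries k n z) < 1 ↔ PowerSeries.X ∣ z := by
  rw [PSF.val_lt_one_iff, PowerSeries.X_dvd_iff, ← PowerSeries.coeff_zero_eq_constantCoeff_apply,
    ← PSF.coeff_ofPowerSeries k n, map_zero]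
  refine ⟨fun h => h 0 le_rfl, fun h q hq => ?_⟩
  rcases hq.eq_or_lt with rfl | hq
  · exact h
  · exact (PSF.val_le_one_iff k _).1 (PSF.val_ofPowerSeries_le_one k n z) q hq

theorem PSF.exists_ofPowerSeries_eq (n : ℕ+) (a : PSF k)
    (ha : PSF.toHahn k a ∈ (laurentEmb k n).fieldRange) (h : PSF.val k a ≤ 1) :
    ∃ z, PSF.ofPowerSeries k n z = a := by
  rw [PSF.val_le_one_iff] at h
  refine ⟨PowerSeries.mk fun m => (PSF.toHahn k a).coeff (natDivHom n m), PSF.ext fun q => ?_⟩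
  by_cases hq : q ∈ Set.range (natDivHom n)
  · obtain ⟨m, rfl⟩ := hq
    rw [PSF.coeff_ofPowerSeries, PowerSeries.coeff_mk]
  · rw [PSF.coeff_ofPowerSeries_of_notMem k n _ hq, eq_comm]
    by_contra h0
    obtain ⟨m, hm⟩ := (mem_laurentEmb_range_iff k n _).1 ha q h0
    have hq0 : 0 ≤ q := not_lt.1 fun hlt => h0 (h q hlt)
    have hm0 : 0 ≤ m := by
      have : divHom n 0 ≤ divHom n m := by
        rw [map_zero]
        exact hq0.trans_eq hm
      exact (divHom_le_iff n 0 m).1 this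
    refine hq ⟨m.toNat, ?_⟩
    change ((m.toNat : ℤ) : ℚ) / n = q
    rw [Int.toNat_of_nonneg hm0, hm]

theorem PSF.exists_common_denominator (s : Finset (PSF k)) :
    ∃ n : ℕ+, ∀ a ∈ s, PSF.toHahn k a ∈ (laurentEmb k n).fieldRange := by
  classical
  induction s using Finset.induction_on with
  | empty => exact ⟨1, by simp⟩
  | insert a s _ ih =>
    obtain ⟨n, hn⟩ := ih
    obtain ⟨m, hm⟩ := Set.mem_iUnion.1 a.2
    refine ⟨m * n, fun b hb => ?_⟩
    rcases Finset.mem_insert.1 hb with rfl | hb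
    · exact laurentEmb_range_mono k (dvd_mul_right m n) hm
    · exact laurentEmb_range_mono k (dvd_mul_left n m) (hn b hb)

/-- Finitely many series share a denominator `n`; the integral ones lie in `k[[t^(1/n)]]`, where
`t^(1/n)` divides every nonunit. -/
theorem PSF.isLocallyCompleteWithCoeffField :
    IsLocallyCompleteWithCoeffField (PSF.val k) (PSF.const k) where
  map_le_one c := by
    rw [PSF.val_le_one_iff]
    intro q hq
    rw [PSF.toHahn_const, HahnSeries.coeff_single_of_ne hq.ne]
  exists_residue a ha := by
    refine ⟨(PSF.toHahn k a).coeff 0, ?_⟩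
    rw [PSF.val_lt_one_iff]
    intro q hq
    rw [map_sub, HahnSeries.coeff_sub, PSF.toHahn_const]
    rcases hq.eq_or_lt with rfl | hq
    · rw [HahnSeries.coeff_single_same, sub_self]
    · rw [(PSF.val_le_one_iff k a).1 ha q hq, HahnSeries.coeff_single_of_ne hq.ne, sub_zero]
  exists_isAdicComplete s hs := by
    obtain ⟨n, hn⟩ := PSF.exists_common_denominator k s
    refine ⟨PowerSeries k, inferInstance, PSF.ofPowerSeries k n, PowerSeries.C, PowerSeries.X,
      PSF.ofPowerSeries_injective k n, RingHom.ext fun c => PSF.ofPowerSeries_C k n c,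
      inferInstance, PSF.val_ofPowerSeries_le_one k n,
      (PSF.val_ofPowerSeries_lt_one_iff k n _).2 dvd_rfl, fun a ha => ?_⟩
    obtain ⟨z, rfl⟩ := PSF.exists_ofPowerSeries_eq k n a (hn a ha) (hs a ha)
    exact ⟨z, rfl, (PSF.val_ofPowerSeries_lt_one_iff k n z).1⟩

end Puiseux

/-! ### Adic completeness of a complete valuation ring -/

section ValuedComplete

variable {L : Type*} [Field L] {Γ : Type*} [LinearOrderedCommGroupWithZero Γ]

theorem Valuation.mem_span_singleton_pow_iff {v : Valuation L Γ} (π x : v.valuationSubring)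
    (n : ℕ) : x ∈ (Ideal.span {π} ^ n • ⊤ : Ideal v.valuationSubring) ↔ v x ≤ v π ^ n := by
  rw [smul_eq_mul, Ideal.mul_top, Ideal.span_singleton_pow, Ideal.mem_span_singleton,
    Valuation.Integers.dvd_iff_le (Valuation.valuationSubring.integers v), map_pow, map_pow]
  rfl

variable [Valued L Γ]

theorem Valued.exists_val_sub_lt_of_mem_closure {s : Set L} {x y : L} (hx : x ∈ closure s)
    (hy : y ≠ 0) : ∃ a ∈ s, (Valued.v : Valuation L Γ) (a - x) < Valued.v y := by
  have hr : (Valued.v : Valuation L Γ).restrict y ≠ 0 := by simpa using hy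
  have hmem : {z : L | (Valued.v : Valuation L Γ).restrict (z - x) <
      (Valued.v : Valuation L Γ).restrict y} ∈ nhds x :=
    Valued.mem_nhds.2 ⟨Units.mk0 _ hr, subset_rfl⟩
  obtain ⟨a, ha, has⟩ := mem_closure_iff_nhds.1 hx _ hmem
  exact ⟨a, has, (Valuation.restrict_lt_iff _).1 ha⟩

/-- By `hpow` the powers of `π` become smaller than any nonzero value, so `π`-adic Cauchy sequences
are Cauchy for the valuation. -/
theorem Valued.isAdicComplete_span_singleton [CompleteSpace L]
    (π : (Valued.v : Valuation L Γ).valuationSubring) (hπ0 : (π : L) ≠ 0)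
    (hpow : ∀ γ : Γ, γ ≠ 0 → ∃ n : ℕ, Valued.v (π : L) ^ n < γ) :
    IsAdicComplete (Ideal.span {π}) (Valued.v : Valuation L Γ).valuationSubring where
  haus' x hx := by
    by_contra h0
    have hx0 : Valued.v (x : L) ≠ (0 : Γ) := by simpa using h0
    obtain ⟨n, hn⟩ := hpow _ hx0
    have := hx n
    rw [SModEq.zero, Valuation.mem_span_singleton_pow_iff] at this
    exact absurd hn (not_lt.2 this)
  prec' f hf := by
    have hπ : Valued.v (π : L) ≤ (1 : Γ) := π.2
    have hle : ∀ {m n}, m ≤ n → Valued.v ((f m : L) - f n) ≤ (Valued.v (π : L) : Γ) ^ m := by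
      intro m n h
      have := hf h
      rwa [SModEq.sub_mem, Valuation.mem_span_singleton_pow_iff] at this
    have hc : CauchySeq fun n => (f n : L) := by
      rw [(Valued.hasBasis_uniformity L Γ).cauchySeq_iff]
      rintro γ -
      obtain ⟨N, hN⟩ := hpow (MonoidWithZeroHom.ValueGroup₀.embedding γ.1) (by simp)
      refine ⟨N, fun m hm n hn => ?_⟩
      change Valued.v.restrict _ < γ.1
      rw [Valuation.restrict_lt_iff_lt_embedding]
      refine lt_of_le_of_lt ?_ hN
      rw [show (f n : L) - f m = (f N - f m) - (f N - f n) by ring]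
      exact (Valuation.map_sub _ _ _).trans (max_le (hle hm) (hle hn))
    obtain ⟨ℓ, hℓ⟩ := cauchySeq_tendsto_of_complete hc
    -- Compare both with some `f n`, `n ≥ m`, that is within `v (π^m)` of the limit.
    have hlim : ∀ m, Valued.v ((f m : L) - ℓ) ≤ (Valued.v (π : L) : Γ) ^ m := by
      intro m
      have hcl : ℓ ∈ closure ((fun n => (f n : L)) '' Set.Ici m) :=
        mem_closure_of_tendsto hℓ ((Filter.eventually_ge_atTop m).mono
          fun n hn => Set.mem_image_of_mem _ hn)
      obtain ⟨_, ⟨n, hn, rfl⟩, h⟩ :=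
        Valued.exists_val_sub_lt_of_mem_closure (Γ := Γ) hcl (pow_ne_zero m hπ0)
      rw [← sub_add_sub_cancel (f m : L) (f n) ℓ]
      rw [map_pow] at h
      exact (Valuation.map_add _ _ _).trans (max_le (hle hn) h.le)
    have hℓ1 : Valued.v ℓ ≤ (1 : Γ) := by
      rw [← sub_sub_cancel (f 0 : L) ℓ]
      refine (Valuation.map_sub _ _ _).trans (max_le (f 0).2 ?_)
      simpa using hlim 0
    refine ⟨⟨ℓ, hℓ1⟩, fun n => ?_⟩
    rw [SModEq.sub_mem, Valuation.mem_span_singleton_pow_iff]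
    exact hlim n

end ValuedComplete

/-! ### The completion of the Puiseux series field -/

section Completion

variable (k : Type u) [Field k]

theorem exists_pow_lt_of_lt_one_withTop {γ δ : Multiplicative (WithTop ℚ)ᵒᵈ} (hγ : γ < 1)
    (hδ : δ ≠ 0) : ∃ n : ℕ, γ ^ n < δ := by
  induction γ using Multiplicative.rec with | _ a => ?_
  induction δ using Multiplicative.rec with | _ b => ?_
  induction a using OrderDual.rec with | _ a => ?_
  induction b using OrderDual.rec with | _ b => ?_
  have ha : 0 < a := hγ
  have hb : b ≠ ⊤ := hδ
  suffices ∃ n : ℕ, b < n • a from this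
  lift b to ℚ using hb
  induction a using WithTop.recTopCoe with
  -- Here `γ = 0`; otherwise the archimedean property of `ℚ` applies.
  | top => exact ⟨1, by rw [one_nsmul]; exact WithTop.coe_lt_top b⟩
  | coe a =>
    obtain ⟨n, hn⟩ := exists_lt_nsmul (WithTop.coe_pos.1 ha) b
    exact ⟨n, by exact_mod_cast hn⟩

theorem PSFCompletion.exists_val_sub_lt (x : PSFCompletion k) {y : PSFCompletion k} (hy : y ≠ 0) :
    ∃ a : PSF k, (Valued.v : Valuation (PSFCompletion k) (Multiplicative (WithTop ℚ)ᵒᵈ))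
      (x - PSF.toCompletion k a) < Valued.v y := by
  have hd : DenseRange (PSF.toCompletion k) :=
    UniformSpace.Completion.denseRange_coe.comp
      (WithVal.equiv (PSF.val k)).symm.surjective.denseRange
      (UniformSpace.Completion.continuous_coe _)
  obtain ⟨_, ⟨a, rfl⟩, h⟩ := Valued.exists_val_sub_lt_of_mem_closure
    (Γ := Multiplicative (WithTop ℚ)ᵒᵈ) (hd x) hy
  exact ⟨a, by rwa [Valuation.map_sub_swap]⟩

theorem PSFCompletion.exists_val_eq (x : PSFCompletion k) :
    ∃ a : PSF k, PSF.val k a =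
      (Valued.v : Valuation (PSFCompletion k) (Multiplicative (WithTop ℚ)ᵒᵈ)) x := by
  rcases eq_or_ne x 0 with rfl | hx
  · exact ⟨0, by rw [map_zero, map_zero]⟩
  obtain ⟨a, ha⟩ := PSFCompletion.exists_val_sub_lt k x hx
  refine ⟨a, ?_⟩
  rw [← PSF.val_toCompletion]
  exact Valuation.map_eq_of_sub_lt _ (by rwa [Valuation.map_sub_swap])

theorem PSFCompletion.exists_val_pow_eq (x : PSFCompletion k) (n : ℕ) (hn : n ≠ 0) :
    ∃ y : PSFCompletion k,
      (Valued.v : Valuation (PSFCompletion k) (Multiplicative (WithTop ℚ)ᵒᵈ)) y ^ n =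
        Valued.v x := by
  obtain ⟨a, ha⟩ := PSFCompletion.exists_val_eq k x
  obtain ⟨b, hb⟩ := PSF.exists_val_pow_eq k a n hn
  exact ⟨PSF.toCompletion k b, by rw [PSF.val_toCompletion, hb, ha]⟩

theorem PSFCompletion.isLocallyCompleteWithCoeffField :
    IsLocallyCompleteWithCoeffField
      (Valued.v : Valuation (PSFCompletion k) (Multiplicative (WithTop ℚ)ᵒᵈ))
      ((PSF.toCompletion k).comp (PSF.const k)) where
  map_le_one c := by
    rw [RingHom.comp_apply, PSF.val_toCompletion]
    exact (PSF.isLocallyCompleteWithCoeffField k).map_le_one c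
  exists_residue x hx := by
    obtain ⟨a, ha⟩ := PSFCompletion.exists_val_sub_lt k x one_ne_zero
    rw [map_one] at ha
    have ha1 : PSF.val k a ≤ 1 := by
      rw [← PSF.val_toCompletion, ← sub_sub_cancel x (PSF.toCompletion k a)]
      exact (Valuation.map_sub _ _ _).trans (max_le hx ha.le)
    obtain ⟨c, hc⟩ := (PSF.isLocallyCompleteWithCoeffField k).exists_residue a ha1
    refine ⟨c, ?_⟩
    rw [← PSF.val_toCompletion, map_sub] at hc
    rw [← sub_add_sub_cancel x (PSF.toCompletion k a)]
    exact Valuation.map_add_lt _ ha hc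
  exists_isAdicComplete s hs := by
    classical
    let v : Valuation (PSFCompletion k) (Multiplicative (WithTop ℚ)ᵒᵈ) := Valued.v
    let τ : PSFCompletion k := PSF.toCompletion k (PSF.ofPowerSeries k 1 PowerSeries.X)
    have hτ0 : τ ≠ 0 := by
      rw [Ne, map_eq_zero, map_eq_zero_iff _ (PSF.ofPowerSeries_injective k 1)]
      exact PowerSeries.X_ne_zero
    have hτ1 : v τ < 1 := by
      change Valued.v _ < _
      rw [PSF.val_toCompletion]
      exact (PSF.val_ofPowerSeries_lt_one_iff k 1 _).2 dvd_rfl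
    -- No nonunit divides all nonunits, since the value group is dense, so `π` depends on `s`.
    -- Inserting `τ`, the image of `t`, ensures `π ≠ 0`.
    obtain ⟨π, hπ, hmax⟩ := Finset.exists_max_image (insert τ (s.filter fun x => v x < 1)) v
      (Finset.insert_nonempty _ _)
    have hπ1 : v π < 1 := by
      rcases Finset.mem_insert.1 hπ with rfl | hπ
      · exact hτ1
      · exact (Finset.mem_filter.1 hπ).2
    have hπ0 : π ≠ 0 := by
      rintro rfl
      have := hmax τ (Finset.mem_insert_self _ _)
      rw [map_zero, le_zero_iff, map_eq_zero] at this
      exact hτ0 this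
    refine ⟨v.valuationSubring, inferInstance, v.valuationSubring.subtype,
      ((PSF.toCompletion k).comp (PSF.const k)).codRestrict v.valuationSubring.toSubring
        fun c => ?_, ⟨π, hπ1.le⟩, Subtype.val_injective, rfl,
      Valued.isAdicComplete_span_singleton _ hπ0
        fun γ hγ => exists_pow_lt_of_lt_one_withTop hπ1 hγ,
      fun a => a.2, hπ1, fun x hx => ⟨⟨x, hs x hx⟩, rfl, fun hx1 => ?_⟩⟩
    · exact (PSF.val_toCompletion k _).trans_le
        ((PSF.isLocallyCompleteWithCoeffField k).map_le_one c)
    · rw [Valuation.Integers.dvd_iff_le (Valuation.valuationSubring.integers v)]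
      exact hmax x (Finset.mem_insert_of_mem (Finset.mem_filter.2 ⟨hx, hx1⟩))

end Completion

/-! ### Countability of discrete subsets, and transcendence degree -/

section Countability

/-- Two elements of `S` with the same chosen neighbour in `D` differ by a value `< 1`, hence are
equal. -/
theorem Valuation.countable_of_discrete {K Γ : Type*} [Field K]
    [LinearOrderedCommGroupWithZero Γ] (v : Valuation K Γ) {D S : Set K} (hD : D.Countable)
    (hdense : ∀ x, ∃ d ∈ D, v (x - d) < 1)
    (hS : ∀ x ∈ S, ∀ y ∈ S, v (x - y) < 1 → x = y) : S.Countable := by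
  choose d hd hlt using hdense
  refine Set.MapsTo.countable_of_injOn (f := d) (fun x _ => hd x) (fun x hx y hy hxy => ?_) hD
  refine hS x hx y hy ?_
  rw [← sub_sub_sub_cancel_right x y (d x)]
  refine (Valuation.map_sub _ _ _).trans_lt (max_lt (hlt x) ?_)
  rw [hxy]
  exact hlt y

theorem countable_quot {K : Type*} [Field K] {S : Set K} (hS : S.Countable) :
    Countable (quot S) := by
  rw [← Cardinal.mk_le_aleph0_iff]
  exact (Subfield.cardinalMk_closure_le_max S).trans
    (max_le (Cardinal.le_aleph0_iff_set_countable.2 hS) le_rfl)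

/-- Otherwise `K` is algebraic over the countable ring generated by a transcendence basis. -/
theorem Algebra.aleph0_lt_trdeg (F K : Type u) [Field F] [Field K] [Algebra F K] [Countable F]
    [Uncountable K] : Cardinal.aleph0 < Algebra.trdeg F K := by
  by_contra h
  obtain ⟨s, hs⟩ := exists_isTranscendenceBasis F K
  have hs' : Cardinal.mk s ≤ Cardinal.aleph0 := by
    rw [hs.cardinalMk_eq_trdeg]
    exact not_lt.1 h
  have hA : Cardinal.mk (Algebra.adjoin F (Set.range ((↑) : s → K))) ≤ Cardinal.aleph0 := by
    refine (Algebra.cardinalMk_adjoin_le F _).trans (max_le (max_le ?_ ?_) le_rfl)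
    · exact Cardinal.mk_le_aleph0_iff.2 inferInstance
    · rwa [Subtype.range_coe]
  have := hs.isAlgebraic
  have hK := (Algebra.IsAlgebraic.cardinalMk_le_max
    (Algebra.adjoin F (Set.range ((↑) : s → K))) K).trans (max_le hA le_rfl)
  exact not_countable (Cardinal.mk_le_aleph0_iff.1 hK)

theorem countable_quot_and_aleph0_lt_trdeg {K : Type u} [Field K] [Uncountable K] {S : Set K}
    (hS : S.Countable) :
    Countable (quot S) ∧ Cardinal.aleph0 < Algebra.trdeg (quot S) K :=
  have := countable_quot hS
  ⟨this, Algebra.aleph0_lt_trdeg (quot S) K⟩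

theorem quot_ne_top {K : Type*} [Field K] [Uncountable K] {S : Set K} (hS : S.Countable) :
    quot S ≠ ⊤ := by
  intro h
  have := countable_quot hS
  rw [h] at this
  exact not_countable (α := K) (Subfield.topEquiv.symm.injective.countable)

theorem IsAdditiveComplement.countable {K Γ : Type*} [Field K]
    [LinearOrderedCommGroupWithZero Γ] {v : Valuation K Γ} {D : Set K} (hD : D.Countable)
    (hdense : ∀ x, ∃ d ∈ D, v (x - d) < 1) {R : NonUnitalSubring K}
    (hR : IsAdditiveComplement R v.valuationSubring) : (R : Set K).Countable :=
  v.countable_of_discrete hD hdense fun _ hx _ hy h =>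
    sub_eq_zero.1 (hR.eq_zero_of_mem _ (sub_mem hx hy) h.le)

section Ordered

theorem Valuation.map_abs {K Γ : Type*} [Field K] [LinearOrder K]
    [LinearOrderedCommGroupWithZero Γ] (v : Valuation K Γ) (a : K) : v |a| = v a := by
  rcases abs_choice a with h | h <;> rw [h]
  exact v.map_neg a

variable {K Γ : Type*} [Field K] [LinearOrder K] [IsStrictOrderedRing K]
  [LinearOrderedCommGroupWithZero Γ] {v : Valuation K Γ}

theorem Valuation.abs_lt_one_of_lt_one (hv : ∀ a b : K, 0 ≤ a → a ≤ b → v a ≤ v b) {a : K}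
    (ha : v a < 1) : |a| < 1 := by
  by_contra h
  have := hv 1 |a| zero_le_one (not_lt.1 h)
  rw [map_one, v.map_abs] at this
  exact absurd ha (not_lt.2 this)

theorem IsIntegerPart.countable (hv : ∀ a b : K, 0 ≤ a → a ≤ b → v a ≤ v b) {D : Set K}
    (hD : D.Countable) (hdense : ∀ x, ∃ d ∈ D, v (x - d) < 1) {I : Subring K}
    (hI : IsIntegerPart I) : (I : Set K).Countable := by
  refine v.countable_of_discrete hD hdense fun x hx y hy h => ?_
  have h1 := abs_lt.1 (Valuation.abs_lt_one_of_lt_one hv h)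
  rcases lt_trichotomy x y with hlt | rfl | hlt
  · have := hI.discrete _ (sub_mem hy hx) (sub_pos.2 hlt)
    linarith
  · rfl
  · have := hI.discrete _ (sub_mem hx hy) (sub_pos.2 hlt)
    linarith

/-- Adding the integers to an additive complement of the ring of finite elements yields an integer
part. -/
theorem IsAdditiveComplement.isIntegerPart_addInt {R : NonUnitalSubring K} {O : ValuationSubring K}
    (hR : IsAdditiveComplement R O) (hO : ∀ a, a ∈ O ↔ ∃ n : ℕ, |a| ≤ n) :
    IsIntegerPart (addInt R) where
  discrete := by
    rintro _ ⟨r, hr, n, rfl⟩ hpos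
    by_cases hrO : r ∈ O
    · obtain rfl := hR.eq_zero_of_mem r hr hrO
      rw [zero_add] at hpos ⊢
      exact_mod_cast hpos
    rw [hO] at hrO
    push Not at hrO
    -- An infinite `r` satisfies `|r| > |n| + 1`, so `r + n` has the sign of `r` and absolute value
    -- above 1.
    have h := hrO (n.natAbs + 1)
    have hn : |(n : K)| = (n.natAbs : K) := by
      rw [Nat.cast_natAbs, Int.cast_abs]
    have hn1 := neg_abs_le (n : K)
    have hn2 := le_abs_self (n : K)
    push_cast at h
    rcases abs_cases r with ⟨h1, _⟩ | ⟨h1, _⟩ <;> rw [h1] at h <;> linarith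
  exists_floor a := by
    obtain ⟨r, hr, b, hb, rfl⟩ := hR.exists_add a
    obtain ⟨N, hN⟩ := (hO b).1 hb
    obtain ⟨n, hn, hmax⟩ := Int.exists_greatest_of_bdd (P := fun n : ℤ => (n : K) ≤ b)
      ⟨N, fun z hz => by exact_mod_cast hz.trans ((le_abs_self b).trans hN)⟩
      ⟨-N, by
        have := (abs_le.1 hN).1
        push_cast
        exact this⟩
    refine ⟨r + n, ⟨r, hr, n, rfl⟩, by linarith, ?_⟩
    have : ¬ ((n + 1 : ℤ) : K) ≤ b := fun h => by
      have := hmax _ h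
      lia
    push_cast at this
    linarith

end Ordered

end Countability

/-! ### The complement of negative exponents, and uncountability -/

section PuiseuxComplement

variable (k : Type u) [Field k]

theorem PSF.countable_finite_support [Countable k] :
    {a : PSF k | (PSF.toHahn k a).support.Finite}.Countable := by
  refine Set.countable_coe_iff.1 (Function.Injective.countable
    (f := fun a : {a : PSF k | (PSF.toHahn k a).support.Finite} =>
      Finsupp.ofSupportFinite (PSF.toHahn k a.1).coeff a.2) fun a b h => ?_)
  exact Subtype.ext (PSF.ext fun q => DFunLike.congr_fun h q)

theorem PSF.countable_neg [Countable k] : Countable (PSF.neg k) :=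
  ((PSF.countable_finite_support k).mono fun _ ha => ha.1).to_subtype

theorem PSF.exists_neg_add (a : PSF k) :
    ∃ r ∈ PSF.neg k, PSF.val k (a - r) ≤ 1 := by
  obtain ⟨n, hn⟩ := PSF.exists_support_subset k a
  have hsub : (HahnSeries.truncLT 0 (PSF.toHahn k a)).support ⊆
      (PSF.toHahn k a).support ∩ Set.Iio 0 := by
    intro q hq
    rw [HahnSeries.mem_support, HahnSeries.coeff_truncLT] at hq
    by_cases h : q < 0
    · rw [if_pos h] at hq
      exact ⟨hq, h⟩
    · exact absurd (if_neg h) hq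
  let r := PSF.mk k (HahnSeries.truncLT 0 (PSF.toHahn k a)) n fun q hq => hn q (hsub hq).1
  have hn0 : (0 : ℚ) < ((n : ℕ) : ℚ) := by exact_mod_cast n.pos
  refine ⟨r, ⟨?_, fun q hq => (hsub hq).2⟩, ?_⟩
  -- The negative exponents are `m / n` with `m < 0` bounded below by the order, hence finite in
  -- number.
  · refine (((Set.finite_Ico ⌊(PSF.toHahn k a).order * n⌋ 0).image
      fun m : ℤ => (m : ℚ) / (n : ℚ))).subset ?_
    intro q hq
    obtain ⟨hqa, hq0⟩ := hsub hq
    obtain ⟨m, rfl⟩ := hn q hqa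
    refine ⟨m, ⟨?_, ?_⟩, rfl⟩
    · have := HahnSeries.order_le_of_coeff_ne_zero hqa
      rw [le_div_iff₀ hn0] at this
      exact_mod_cast (Int.floor_le _).trans this
    · rw [Set.mem_Iio, div_lt_iff₀ hn0, zero_mul] at hq0
      exact_mod_cast hq0
  · rw [PSF.val_le_one_iff]
    intro q hq
    rw [map_sub, HahnSeries.coeff_sub, PSF.toHahn_mk, HahnSeries.coeff_truncLT, if_pos hq, sub_self]

theorem PSF.eq_zero_of_mem_neg {r : PSF k} (hr : r ∈ PSF.neg k) (h : PSF.val k r ≤ 1) :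
    r = 0 := by
  refine PSF.ext fun q => ?_
  rw [map_zero, HahnSeries.coeff_zero]
  by_contra h0
  exact h0 ((PSF.val_le_one_iff k r).1 h q (hr.2 q h0))

theorem PSF.isAdditiveComplement_neg : IsAdditiveComplement (PSF.neg k) (PSF.valRing k) where
  eq_zero_of_mem _ hr h := PSF.eq_zero_of_mem_neg k hr h
  exists_add a := by
    obtain ⟨r, hr, h⟩ := PSF.exists_neg_add k a
    exact ⟨r, hr, a - r, h, (add_sub_cancel r a).symm⟩

theorem PSFCompletion.isAdditiveComplement_neg :
    IsAdditiveComplement ((PSF.neg k).map (PSF.toCompletion k)) (PSFCompletion.valRing k) where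
  eq_zero_of_mem := by
    rintro _ ⟨r, hr, rfl⟩ h
    have h' : PSF.val k r ≤ 1 := (PSF.val_toCompletion k r).symm.trans_le h
    change PSF.toCompletion k r = 0
    rw [PSF.eq_zero_of_mem_neg k hr h', map_zero]
  exists_add x := by
    obtain ⟨a, ha⟩ := PSFCompletion.exists_val_sub_lt k x one_ne_zero
    rw [map_one] at ha
    obtain ⟨r, hr, h⟩ := PSF.exists_neg_add k a
    refine ⟨PSF.toCompletion k r, ⟨r, hr, rfl⟩, x - PSF.toCompletion k r, ?_,
      (add_sub_cancel _ x).symm⟩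
    rw [← PSF.val_toCompletion, map_sub] at h
    rw [Valuation.mem_valuationSubring_iff, ← sub_add_sub_cancel x (PSF.toCompletion k a)]
    exact (Valuation.map_add _ _ _).trans (max_le ha.le h)

theorem PSF.exists_finite_support_near (a : PSF k) :
    ∃ d ∈ {a : PSF k | (PSF.toHahn k a).support.Finite}, PSF.val k (a - d) < 1 := by
  obtain ⟨r, hr, h⟩ := PSF.exists_neg_add k a
  obtain ⟨c, hc⟩ := (PSF.isLocallyCompleteWithCoeffField k).exists_residue _ h
  refine ⟨r + PSF.const k c, ?_, by rwa [← sub_sub]⟩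
  rw [Set.mem_ofPred_eq, map_add]
  exact (hr.1.union ((Set.finite_singleton 0).subset
    (HahnSeries.support_single_subset (a := (0 : ℚ)) (r := c)))).subset
    (HahnSeries.support_add_subset _ _)

theorem PSFCompletion.exists_finite_support_near (x : PSFCompletion k) :
    ∃ d ∈ PSF.toCompletion k '' {a : PSF k | (PSF.toHahn k a).support.Finite},
      (Valued.v : Valuation (PSFCompletion k) (Multiplicative (WithTop ℚ)ᵒᵈ)) (x - d) < 1 := by
  obtain ⟨a, ha⟩ := PSFCompletion.exists_val_sub_lt k x one_ne_zero
  rw [map_one] at ha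
  obtain ⟨d, hd, h⟩ := PSF.exists_finite_support_near k a
  refine ⟨_, ⟨d, hd, rfl⟩, ?_⟩
  rw [← PSF.val_toCompletion, map_sub] at h
  rw [← sub_add_sub_cancel x (PSF.toCompletion k a)]
  exact Valuation.map_add_lt _ ha h

/-- Subsets of `ℕ` embed through the power series of their indicator functions. -/
instance PSF.uncountable : Uncountable (PSF k) := by
  have h : Function.Injective fun s : Set ℕ =>
      PSF.ofPowerSeries k 1 (PowerSeries.mk (s.indicator 1)) := by
    intro s t hst
    have := PSF.ofPowerSeries_injective k 1 hst
    ext m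
    have hm := congrArg (PowerSeries.coeff m) this
    rw [PowerSeries.coeff_mk, PowerSeries.coeff_mk] at hm
    by_cases h1 : m ∈ s <;> by_cases h2 : m ∈ t <;> simp_all
  have : Uncountable (Set ℕ) := Cardinal.aleph0_lt_mk_iff.1 (by
    rw [Cardinal.mk_set, Cardinal.mk_nat]
    exact Cardinal.cantor _)
  exact h.uncountable

instance PSFCompletion.uncountable : Uncountable (PSFCompletion k) :=
  (PSF.toCompletion k).injective.uncountable

end PuiseuxComplement

/-! ### Compatibility of order and valuation -/

section PuiseuxOrder

variable (k : Type u) [Field k] [LinearOrder k]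

theorem PSF.const_nonneg {c : k} (hc : 0 ≤ c) : 0 ≤ PSF.const k c := by
  rw [PSF.le_iff, map_zero]
  change 0 ≤ toLex (PSF.toHahn k (PSF.const k c))
  rw [← HahnSeries.leadingCoeff_nonneg_iff]
  change 0 ≤ (PSF.toHahn k (PSF.const k c)).leadingCoeff
  rwa [PSF.toHahn_const, HahnSeries.leadingCoeff_of_single]

variable [IsStrictOrderedRing k]

theorem PSF.exists_abs_le_natCast [Archimedean k] {a : PSF k} (ha : PSF.val k a ≤ 1) :
    ∃ n : ℕ, |a| ≤ n := by
  obtain ⟨c, hc⟩ := (PSF.isLocallyCompleteWithCoeffField k).exists_residue a ha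
  obtain ⟨n, hn⟩ := exists_nat_ge |c|
  have h1 := (Valuation.abs_lt_one_of_lt_one (fun _ _ => PSF.val_le_val k) hc).le
  have h2 : |PSF.const k c| ≤ n := by
    rw [abs_le, ← map_natCast (PSF.const k), ← sub_nonneg, ← sub_nonneg (b := PSF.const k c),
      ← map_neg, ← map_sub, ← map_sub]
    exact ⟨PSF.const_nonneg k (sub_nonneg.2 (abs_le.1 hn).1),
      PSF.const_nonneg k (sub_nonneg.2 (abs_le.1 hn).2)⟩
  -- `n` bounds the residue, and the infinitesimal remainder adds less than 1.
  refine ⟨n + 1, ?_⟩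
  have h3 := abs_add_le (a - PSF.const k c) (PSF.const k c)
  rw [sub_add_cancel] at h3
  push_cast
  linarith

theorem Valuation.le_one_of_abs_le_natCast {K Γ : Type*} [Field K] [LinearOrder K]
    [IsStrictOrderedRing K] [LinearOrderedCommGroupWithZero Γ] {v : Valuation K Γ}
    (hv : ∀ a b : K, 0 ≤ a → a ≤ b → v a ≤ v b) {a : K} {n : ℕ} (h : |a| ≤ n) : v a ≤ 1 := by
  rw [← v.map_abs]
  exact (hv _ _ (abs_nonneg a) h).trans (natCast_mem v.valuationSubring n)

/-- If `v b < v a`, then `v (b - a) = v a`. Nonnegative Puiseux series `a'`, `c'` close to `a` and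
`b - a` then satisfy `v (a' + c') < v a'`, which monotonicity on `PSF k` excludes. -/
theorem PSFCompletion.val_le_val {a b : PSFCompletion k} (ha : 0 ≤ a) (hab : a ≤ b) :
    (Valued.v : Valuation (PSFCompletion k) (Multiplicative (WithTop ℚ)ᵒᵈ)) a ≤ Valued.v b := by
  by_contra hcon
  rw [not_le] at hcon
  have ha0 : a ≠ 0 := by
    rintro rfl
    rw [map_zero] at hcon
    exact not_lt_zero hcon
  have hc : (Valued.v : Valuation (PSFCompletion k) (Multiplicative (WithTop ℚ)ᵒᵈ)) (b - a) =
      Valued.v a := Valuation.map_sub_eq_of_lt_right _ hcon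
  have hc0 : b - a ≠ 0 := by
    intro h0
    rw [h0, map_zero, eq_comm, map_eq_zero] at hc
    exact ha0 hc
  obtain ⟨a', ha', haa⟩ := PSFCompletion.exists_near k
    ((PSFCompletion.nonneg_iff k a).1 ha) ha0
  obtain ⟨c', hc', hcc⟩ := PSFCompletion.exists_near k
    ((PSFCompletion.nonneg_iff k (b - a)).1 (sub_nonneg.2 hab)) hc0
  rw [hc] at hcc
  have h1 := Valuation.map_add_lt _ (Valuation.map_add_lt _ haa hcc) hcon
  rw [show PSF.toCompletion k a' - a + (PSF.toCompletion k c' - (b - a)) + b =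
    PSF.toCompletion k (a' + c') by rw [map_add]; ring, ← Valuation.map_eq_of_sub_lt _ haa,
    PSF.val_toCompletion, PSF.val_toCompletion] at h1
  exact absurd (PSF.val_le_val k ha' (le_add_of_nonneg_right (α := PSF k) hc')) (not_le.2 h1)

theorem PSFCompletion.exists_abs_le_natCast [Archimedean k] {x : PSFCompletion k}
    (hx : (Valued.v : Valuation (PSFCompletion k) (Multiplicative (WithTop ℚ)ᵒᵈ)) x ≤ 1) :
    ∃ n : ℕ, |x| ≤ n := by
  obtain ⟨a, ha⟩ := PSFCompletion.exists_val_sub_lt k x one_ne_zero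
  rw [map_one] at ha
  have ha1 : PSF.val k a ≤ 1 := by
    rw [← PSF.val_toCompletion, ← sub_sub_cancel x (PSF.toCompletion k a)]
    exact (Valuation.map_sub _ _ _).trans (max_le hx ha.le)
  obtain ⟨n, hn⟩ := PSF.exists_abs_le_natCast k ha1
  have h1 := (Valuation.abs_lt_one_of_lt_one (fun _ _ => PSFCompletion.val_le_val k) ha).le
  have h2 : |PSF.toCompletion k a| ≤ n := by
    rw [abs_le, ← map_natCast (PSF.toCompletion k), ← map_neg,
      (PSF.toCompletion_strictMono k).le_iff_le, (PSF.toCompletion_strictMono k).le_iff_le]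
    exact abs_le.1 hn
  refine ⟨n + 1, ?_⟩
  have h3 := abs_add_le (x - PSF.toCompletion k a) (PSF.toCompletion k a)
  rw [sub_add_cancel] at h3
  push_cast
  linarith

theorem PSF.isIntegerPart_addInt_neg [Archimedean k] : IsIntegerPart (addInt (PSF.neg k)) :=
  (PSF.isAdditiveComplement_neg k).isIntegerPart_addInt fun _ =>
    ⟨PSF.exists_abs_le_natCast k, fun ⟨_, h⟩ =>
      Valuation.le_one_of_abs_le_natCast (fun _ _ => PSF.val_le_val k) h⟩

theorem PSFCompletion.isIntegerPart_addInt_neg [Archimedean k] :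
    IsIntegerPart (addInt ((PSF.neg k).map (PSF.toCompletion k))) :=
  (PSFCompletion.isAdditiveComplement_neg k).isIntegerPart_addInt fun _ =>
    ⟨PSFCompletion.exists_abs_le_natCast k, fun ⟨_, h⟩ =>
      Valuation.le_one_of_abs_le_natCast (fun _ _ => PSFCompletion.val_le_val k) h⟩

theorem PSF.countable_of_isIntegerPart [Countable k] {I : Subring (PSF k)}
    (hI : IsIntegerPart I) : (I : Set (PSF k)).Countable :=
  hI.countable (fun _ _ => PSF.val_le_val k) (PSF.countable_finite_support k)
    (PSF.exists_finite_support_near k)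

theorem PSFCompletion.countable_of_isIntegerPart [Countable k] {I : Subring (PSFCompletion k)}
    (hI : IsIntegerPart I) : (I : Set (PSFCompletion k)).Countable :=
  hI.countable (fun _ _ => PSFCompletion.val_le_val k)
    ((PSF.countable_finite_support k).image _) (PSFCompletion.exists_finite_support_near k)

theorem PSF.isRealClosed [IsRealClosed k] : IsRealClosed (PSF k) :=
  (PSF.isLocallyCompleteWithCoeffField k).isRealClosed (PSF.exists_val_pow_eq k)

theorem PSFCompletion.isRealClosed [IsRealClosed k] : IsRealClosed (PSFCompletion k) :=
  (PSFCompletion.isLocallyCompleteWithCoeffField k).isRealClosed (PSFCompletion.exists_val_pow_eq k)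

end PuiseuxOrder

/-! ### Real algebraic numbers -/

section RealAlgebraic

open Polynomial Filter

/-- The intermediate value theorem applies because, for a positive leading coefficient, both `f(x)`
and `-f(-x)` tend to infinity. -/
theorem Polynomial.exists_isRoot_of_odd_natDegree_real {f : ℝ[X]} (hf : Odd f.natDegree) :
    ∃ x, f.IsRoot x := by
  wlog hlc : 0 ≤ f.leadingCoeff generalizing f
  · obtain ⟨x, hx⟩ := this (f := -f) (by rwa [natDegree_neg])
      (by rw [leadingCoeff_neg]; linarith)
    exact ⟨x, by simpa [IsRoot] using hx⟩
  have hdeg : 0 < f.degree := natDegree_pos_iff_degree_pos.1 hf.pos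
  have htop := tendsto_atTop_of_leadingCoeff_nonneg f hdeg hlc
  have hnat : (-(f.comp (-X))).natDegree = f.natDegree := by
    rw [natDegree_neg, natDegree_comp, natDegree_neg, natDegree_X, mul_one]
  have hbot := tendsto_atTop_of_leadingCoeff_nonneg (-(f.comp (-X)))
    (natDegree_pos_iff_degree_pos.1 (hnat ▸ hf.pos)) (by
      rw [leadingCoeff_neg, leadingCoeff_comp (by simp), leadingCoeff_neg, leadingCoeff_X,
        hf.neg_one_pow]
      linarith)
  obtain ⟨x, hx⟩ := (htop.eventually_ge_atTop 0).exists
  obtain ⟨y, hy⟩ := (hbot.eventually_ge_atTop 0).exists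
  exact mem_range_of_exists_le_of_exists_ge f.continuous
    ⟨-y, by simpa using hy⟩ ⟨x, hx⟩

/-- Square roots and odd-degree roots exist in `ℝ` and are again algebraic over `ℚ`. -/
instance RealAlg.isRealClosed : IsRealClosed RealAlg := by
  refine IsRealClosed.of_linearOrderedField (fun {x} hx => ?_) fun {f} hf => ?_
  · have hx' : (0 : ℝ) ≤ x := hx
    have hs : IsAlgebraic ℚ (Real.sqrt x) := by
      refine IsAlgebraic.of_pow two_pos ?_
      rw [Real.sq_sqrt hx']
      exact mem_algebraicClosure_iff.1 x.2
    exact ⟨⟨Real.sqrt x, mem_algebraicClosure_iff.2 hs⟩, Subtype.ext (Real.mul_self_sqrt hx').symm⟩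
  · obtain ⟨r, hr⟩ := Polynomial.exists_isRoot_of_odd_natDegree_real
      (f := f.map (algebraMap RealAlg ℝ)) (by rwa [natDegree_map])
    have hf0 : f ≠ 0 := by rintro rfl; simp at hf
    have : Algebra.IsAlgebraic ℚ RealAlg := by
      convert! algebraicClosure.isAlgebraic ℚ ℝ
    have halg : IsAlgebraic RealAlg r := ⟨f, hf0, by rwa [IsRoot, eval_map_algebraMap] at hr⟩
    have hr' : r ∈ algebraicClosure ℚ ℝ := mem_algebraicClosure_iff.2 (halg.restrictScalars ℚ)
    refine ⟨⟨r, hr'⟩, Subtype.ext ?_⟩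
    have h2 : f.eval₂ (algebraMap RealAlg ℝ) (algebraMap RealAlg ℝ ⟨r, hr'⟩) = 0 := by
      rw [← eval_map]; exact hr
    rwa [eval₂_at_apply] at h2

instance RealAlg.countable : Countable RealAlg :=
  ((Algebraic.countable ℚ ℝ).mono fun _ => mem_algebraicClosure_iff.1).to_subtype

end RealAlgebraic

theorem theorem4 :
    -- any countable coefficient field: the valued field `PSF k` and its completion
    (∀ (k : Type u) [Field k] [Countable k],
      (Uncountable (PSF k) ∧ HenselianLocalRing (PSF.valRing k) ∧
        Countable (PSF.neg k) ∧ IsAdditiveComplement (PSF.neg k) (PSF.valRing k)) ∧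
      (Uncountable (PSFCompletion k) ∧ HenselianLocalRing (PSFCompletion.valRing k) ∧
        IsAdditiveComplement ((PSF.neg k).map (PSF.toCompletion k)) (PSFCompletion.valRing k)) ∧
      (∀ R : NonUnitalSubring (PSF k), IsAdditiveComplement R (PSF.valRing k) →
        Countable (quot (R : Set (PSF k))) ∧
          Cardinal.aleph0 < Algebra.trdeg (quot (R : Set (PSF k))) (PSF k)) ∧
      (∀ R : NonUnitalSubring (PSFCompletion k),
        IsAdditiveComplement R (PSFCompletion.valRing k) →
        Countable (quot (R : Set (PSFCompletion k))) ∧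
          Cardinal.aleph0 < Algebra.trdeg (quot (R : Set (PSFCompletion k))) (PSFCompletion k))) ∧
    -- any countable ordered coefficient field: integer parts
    (∀ (k : Type u) [Field k] [Countable k] [LinearOrder k] [IsStrictOrderedRing k],
      (∀ I : Subring (PSF k), IsIntegerPart I →
        Countable (quot (I : Set (PSF k))) ∧
          Cardinal.aleph0 < Algebra.trdeg (quot (I : Set (PSF k))) (PSF k)) ∧
      (∀ I : Subring (PSFCompletion k), IsIntegerPart I →
        Countable (quot (I : Set (PSFCompletion k))) ∧
          Cardinal.aleph0 < Algebra.trdeg (quot (I : Set (PSFCompletion k))) (PSFCompletion k)) ∧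
      (Archimedean k →
        IsIntegerPart (addInt (PSF.neg k)) ∧
        IsIntegerPart (addInt ((PSF.neg k).map (PSF.toCompletion k)))) ∧
      (IsRealClosed k → IsRealClosed (PSF k) ∧ IsRealClosed (PSFCompletion k))) ∧
    -- the field of real algebraic numbers as coefficient field
    (IsRealClosed (PSF RealAlg) ∧
      ∀ I : Subring (PSF RealAlg), IsIntegerPart I →
        quot (I : Set (PSF RealAlg)) ≠ ⊤ ∧
        Countable (quot (I : Set (PSF RealAlg))) ∧
        Cardinal.aleph0 < Algebra.trdeg (quot (I : Set (PSF RealAlg))) (PSF RealAlg)) ∧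
    (IsRealClosed (PSFCompletion RealAlg) ∧
      ∀ I : Subring (PSFCompletion RealAlg), IsIntegerPart I →
        quot (I : Set (PSFCompletion RealAlg)) ≠ ⊤ ∧
        Countable (quot (I : Set (PSFCompletion RealAlg))) ∧
        Cardinal.aleph0 < Algebra.trdeg (quot (I : Set (PSFCompletion RealAlg)))
          (PSFCompletion RealAlg)) := by
  refine ⟨fun k _ _ => ⟨?_, ?_, fun R hR => ?_, fun R hR => ?_⟩, fun k _ _ _ _ =>
    ⟨fun I hI => ?_, fun I hI => ?_, fun _ => ?_, fun _ => ?_⟩, ⟨?_, fun I hI => ?_⟩,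
    ?_, fun I hI => ?_⟩
  · exact ⟨inferInstance, (PSF.isLocallyCompleteWithCoeffField k).henselianLocalRing,
      PSF.countable_neg k, PSF.isAdditiveComplement_neg k⟩
  · exact ⟨inferInstance, (PSFCompletion.isLocallyCompleteWithCoeffField k).henselianLocalRing,
      PSFCompletion.isAdditiveComplement_neg k⟩
  · exact countable_quot_and_aleph0_lt_trdeg
      (hR.countable (PSF.countable_finite_support k) (PSF.exists_finite_support_near k))
  · exact countable_quot_and_aleph0_lt_trdeg
      (hR.countable ((PSF.countable_finite_support k).image _)
        (PSFCompletion.exists_finite_support_near k))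
  · exact countable_quot_and_aleph0_lt_trdeg (PSF.countable_of_isIntegerPart k hI)
  · exact countable_quot_and_aleph0_lt_trdeg (PSFCompletion.countable_of_isIntegerPart k hI)
  · exact ⟨PSF.isIntegerPart_addInt_neg k, PSFCompletion.isIntegerPart_addInt_neg k⟩
  · exact ⟨PSF.isRealClosed k, PSFCompletion.isRealClosed k⟩
  · exact PSF.isRealClosed RealAlg
  · have h := PSF.countable_of_isIntegerPart RealAlg hI
    exact ⟨quot_ne_top h, countable_quot_and_aleph0_lt_trdeg h⟩
  · exact PSFCompletion.isRealClosed RealAlg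
  · have h := PSFCompletion.countable_of_isIntegerPart RealAlg hI
    exact ⟨quot_ne_top h, countable_quot_and_aleph0_lt_trdeg h⟩
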